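/- Let $M$ be a smooth real supermanifold of dimension $p|q$ with local coordinates $x^A$ of parity $\widetilde A$, and let $(x^A,p_A)$ be the natural coordinates on $T^*M$, where $p_A$ has parity $\widetilde A$ and $\overline p_A=\frac{\partial x^B}{\partial \overline x^A}p_B$ under a change of coordinates. A tilde denotes parity, and in exponents of $-1$ the parity of a function is denoted like the function. Functions on $M$ are regarded as functions on $T^*M$ through the projection. The canonical Poisson bracket on $T^*M$ is $$\{F,G\}=(-1)^{\widetilde A\widetilde F+\widetilde A}\frac{\partial F}{\partial p_A}\frac{\partial G}{\partial x^A}-(-1)^{\widetilde A\widetilde F}\frac{\partial F}{\partial x^A}\frac{\partial G}{\partial p_A}.$$ Let $(S,Q)$ be an odd Jacobi structure on $M$: $S\in C^\infty(T^*M)$ is an odd function, homogeneous of degree two in the fibre coordinates, i.e. locally $S=\frac12 S^{AB}(x)p_Bp_A$, and $Q=Q^A\frac{\partial}{\partial x^A}$ is an odd vector field on $M$ with symbol $\mathcal Q=Q^Ap_A\in C^\infty(T^*M)$, such that $$Q^2=0,\qquad L_QS=\{\mathcal Q,S\}=0,\qquad \{S,S\}=-2\mathcal Q S.$$ For $f,g\in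 C^\infty(M)$ with $f$ homogeneous, the odd Jacobi bracket and the Hamiltonian vector field $X_f$ are $$[\![f,g]\!]_J=(-1)^{\widetilde f+1}\{\{S,f\},g\}-(-1)^{\widetilde f+1}\{\mathcal Q,fg\},\qquad X_f(g)=(-1)^{\widetilde f}[\![f,g]\!]_J-Q(f)\,g.$$ Let $\phi:M\to M$ be a diffeomorphism of supermanifolds; $\phi^*$ denotes the pull-back of functions on $M$, and also the pull-back of functions on $T^*M$ by the induced diffeomorphism of $T^*M$ (which in natural coordinates sends $x^A$ to $\phi^*x^A$ and $p_A$ to the momentum conjugate to $\phi^*x^A$). Then the following are equivalent: \begin{enumerate} \item $\phi^*[\![f,g]\!]_J=[\![\phi^*f,\phi^*g]\!]_J$ for all $f,g\in C^\infty(M)$ with $f$ homogeneous; \item $\phi^*S=S$ and $\phi^*\mathcal Q=\mathcal Q$; \item for every homogeneous $f\in C^\infty(M)$ the vector fields $X_f$ and $X_{\phi^*f}$ are $\phi$-related, i.e. $\phi^*(X_f(g))=X_{\phi^*f}(\phi^*g)$ for all $g\in C^\infty(M)$. \end{enumerate} -/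

import Mathlib

open scoped TensorProduct ContDiff
open TopologicalSpace CategoryTheory Opposite

universe u

noncomputable section

namespace OddJacobi

/-! ### Superdomains -/

section Superdomain

variable {E : Type}

/-- Extension by zero of a function defined on an open subset. -/
def zeroExt [TopologicalSpace E] (V : Opens E) (f : V → ℝ) : E → ℝ :=
  open Classical in fun x => if h : x ∈ V then f ⟨x, h⟩ else 0

theorem zeroExt_eq_of_mem [TopologicalSpace E] (V : Opens E) (f : V → ℝ) {x : E} (hx : x ∈ V) :
    zeroExt V f x = f ⟨x, hx⟩ := by
  simp [zeroExt, hx]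

variable [NormedAddCommGroup E] [NormedSpace ℝ E]

/-- The algebra `C^∞(V)` of smooth real functions on the open set `V`. -/
def SmoothFun (V : Opens E) : Subalgebra ℝ (V → ℝ) where
  carrier := {f | ContDiffOn ℝ ∞ (zeroExt V f) V}
  mul_mem' := by
    intro f g hf hg
    refine (ContDiffOn.mul hf hg).congr ?_
    intro x hx
    simp [zeroExt_eq_of_mem V _ hx]
  add_mem' := by
    intro f g hf hg
    refine (ContDiffOn.add hf hg).congr ?_
    intro x hx
    simp [zeroExt_eq_of_mem V _ hx]
  algebraMap_mem' := by
    intro r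
    refine (contDiffOn_const (c := r)).congr ?_
    intro x hx
    simp [zeroExt_eq_of_mem V _ hx]

/-- A function on `E` that is smooth on `V`, as an element of `C^∞(V)`. -/
def SmoothFun.mk (V : Opens E) (F : E → ℝ) (hF : ContDiffOn ℝ ∞ F V) : SmoothFun V :=
  ⟨fun x => F x, hF.congr fun _ hx => zeroExt_eq_of_mem V _ hx⟩

/-- Pull-back `f ↦ f ∘ k` along a smooth map `k` with `k(V') ⊆ V`. -/
def SmoothFun.comp {E' : Type} [NormedAddCommGroup E'] [NormedSpace ℝ E']
    (V : Opens E) (V' : Opens E') (k : E' → E) (hk : ContDiff ℝ ∞ k)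
    (hkV : ∀ x ∈ V', k x ∈ V) : SmoothFun V →ₐ[ℝ] SmoothFun V' where
  toFun f := ⟨fun x => f.1 ⟨k x, hkV x x.2⟩, by
    refine (ContDiffOn.comp (t := (V : Set E)) f.2 hk.contDiffOn (fun x hx => hkV x hx)).congr ?_
    intro x hx
    simp [zeroExt_eq_of_mem V' _ hx, zeroExt_eq_of_mem V _ (hkV x hx)]⟩
  map_one' := rfl
  map_mul' _ _ := rfl
  map_zero' := rfl
  map_add' _ _ := rfl
  commutes' _ := rfl

/-- Restriction `C^∞(V) → C^∞(V')` for `V' ⊆ V`. -/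
def SmoothFun.res {V V' : Opens E} (h : V' ≤ V) : SmoothFun V →ₐ[ℝ] SmoothFun V' :=
  SmoothFun.comp V V' id contDiff_id (fun _ hx => h hx)

theorem SmoothFun.differentiable {V : Opens E} (f : SmoothFun V) (x : V) :
    DifferentiableAt ℝ (zeroExt V f.1) (x : E) :=
  (f.2.contDiffAt (V.isOpen.mem_nhds x.2)).differentiableAt (by simp)

/-- The partial derivative of a smooth function in the direction `v`. -/
def SmoothFun.deriv (V : Opens E) (v : E) : SmoothFun V →ₗ[ℝ] SmoothFun V where
  toFun f := SmoothFun.mk V (fun x => fderiv ℝ (zeroExt V f.1) x v)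
    ((f.2.fderiv_of_isOpen V.isOpen (by simp)).clm_apply contDiffOn_const)
  map_add' f g := by
    ext x
    have hE : zeroExt V (f + g).1 = zeroExt V f.1 + zeroExt V g.1 := by
      ext y
      by_cases hy : y ∈ V <;> simp [zeroExt, hy]
    change fderiv ℝ (zeroExt V (f + g).1) x v
      = fderiv ℝ (zeroExt V f.1) x v + fderiv ℝ (zeroExt V g.1) x v
    rw [hE, fderiv_add (SmoothFun.differentiable f x) (SmoothFun.differentiable g x)]
    rfl
  map_smul' r f := by
    ext x
    have hE : zeroExt V (r • f).1 = r • zeroExt V f.1 := by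
      ext y
      by_cases hy : y ∈ V <;> simp [zeroExt, hy]
    change fderiv ℝ (zeroExt V (r • f).1) x v = r • fderiv ℝ (zeroExt V f.1) x v
    rw [hE, fderiv_const_smul (SmoothFun.differentiable f x)]
    rfl

/-- The Grassmann algebra on odd generators labelled by `κ`. -/
abbrev Grassmann (κ : Type) : Type := ExteriorAlgebra ℝ (κ → ℝ)

/-- The superalgebra `C^∞(V) ⊗ Λ` of functions on the superdomain with body `V` and with odd
coordinates labelled by `κ`. -/
abbrev SuperFun (V : Opens E) (κ : Type) : Type := SmoothFun V ⊗[ℝ] Grassmann κ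

/-- Restriction of superfunctions. -/
def SuperFun.res {V V' : Opens E} (κ : Type) (h : V' ≤ V) : SuperFun V κ →ₐ[ℝ] SuperFun V' κ :=
  Algebra.TensorProduct.map (SmoothFun.res h) (AlgHom.id ℝ (Grassmann κ))

/-- The parity involution: `F ↦ (-1)^F F` on homogeneous `F`. -/
def SuperFun.involution (V : Opens E) (κ : Type) : SuperFun V κ →ₐ[ℝ] SuperFun V κ :=
  Algebra.TensorProduct.map (AlgHom.id ℝ (SmoothFun V))
    (CliffordAlgebra.involute (Q := (0 : QuadraticForm ℝ (κ → ℝ))))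

/-- The sign `(-1)^i`. -/
def sgn (i : ZMod 2) : ℝ := (-1) ^ i.val

/-- The superfunctions of parity `i`. -/
def SuperFun.parity (V : Opens E) (κ : Type) (i : ZMod 2) : Submodule ℝ (SuperFun V κ) where
  carrier := {F | SuperFun.involution V κ F = sgn i • F}
  add_mem' := by
    intro F G hF hG
    simp only [Set.mem_ofPred_eq] at *
    rw [map_add, hF, hG, smul_add]
  zero_mem' := by simp
  smul_mem' := by
    intro r F hF
    simp only [Set.mem_ofPred_eq] at *
    rw [map_smul, hF, smul_comm]

/-- Partial derivative along an even direction `v`. -/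
def SuperFun.evenDeriv (V : Opens E) (κ : Type) (v : E) : SuperFun V κ →ₗ[ℝ] SuperFun V κ :=
  LinearMap.rTensor (Grassmann κ) (SmoothFun.deriv V v)

/-- Left partial derivative with respect to the odd coordinate labelled by `j`. -/
def SuperFun.oddDeriv (V : Opens E) (κ : Type) (j : κ) : SuperFun V κ →ₗ[ℝ] SuperFun V κ :=
  LinearMap.lTensor (SmoothFun V)
    (CliffordAlgebra.contractLeft (Q := (0 : QuadraticForm ℝ (κ → ℝ)))
      (LinearMap.proj j : (κ → ℝ) →ₗ[ℝ] ℝ))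

/-- The odd coordinate labelled by `j`. -/
def SuperFun.oddCoord (V : Opens E) (κ : Type) [DecidableEq κ] (j : κ) : SuperFun V κ :=
  1 ⊗ₜ[ℝ] ExteriorAlgebra.ι ℝ (Pi.single j (1 : ℝ))

end Superdomain

/-! ### Coordinates on a superdomain of dimension `p|q` and on its cotangent bundle -/

section Coordinates

variable {p q : ℕ}

/-- Labels `A` of the coordinates `x^A`: `p` even ones and `q` odd ones. -/
abbrev Idx (p q : ℕ) : Type := Fin p ⊕ Fin q

/-- The parity of the coordinate `x^A`. -/
def Idx.parity : Idx p q → ZMod 2 := Sum.elim (fun _ => 0) (fun _ => 1)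

/-- The coordinate function `x^A`. -/
def coord (V : Opens (Fin p → ℝ)) : Idx p q → SuperFun V (Fin q)
  | Sum.inl i => SmoothFun.mk V (fun x => x i) (contDiff_apply ℝ ℝ i).contDiffOn ⊗ₜ[ℝ] 1
  | Sum.inr j => SuperFun.oddCoord V (Fin q) j

/-- The (left) partial derivative `∂/∂x^A`. -/
def coordDeriv (V : Opens (Fin p → ℝ)) :
    Idx p q → SuperFun V (Fin q) →ₗ[ℝ] SuperFun V (Fin q)
  | Sum.inl i => SuperFun.evenDeriv V (Fin q) (Pi.single i 1)
  | Sum.inr j => SuperFun.oddDeriv V (Fin q) j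

/-- The body `V × ℝ^p` of the cotangent bundle of a superdomain with body `V`. -/
def cotBody (V : Opens (Fin p → ℝ)) : Opens ((Fin p → ℝ) × (Fin p → ℝ)) :=
  ⟨{y | y.1 ∈ V}, V.isOpen.preimage continuous_fst⟩

/-- Functions on the cotangent bundle of a superdomain: it is a superdomain of dimension `2p|2q`,
with coordinates `(x^A, p_A)`, the momentum `p_A` having the parity of `x^A`. -/
abbrev CotFun (V : Opens (Fin p → ℝ)) (q : ℕ) : Type := SuperFun (cotBody V) (Fin q ⊕ Fin q)

/-- Pull-back of functions along the projection of the cotangent bundle. -/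
def toCot (V : Opens (Fin p → ℝ)) (q : ℕ) : SuperFun V (Fin q) →ₐ[ℝ] CotFun V q :=
  Algebra.TensorProduct.map
    (SmoothFun.comp V (cotBody V) Prod.fst contDiff_fst (fun _ hx => hx))
    (ExteriorAlgebra.map
      (LinearMap.pi (Sum.elim (fun j => LinearMap.proj j) (fun _ => 0)) :
        (Fin q → ℝ) →ₗ[ℝ] (Fin q ⊕ Fin q → ℝ)))

/-- The momentum `p_A`. -/
def mom (V : Opens (Fin p → ℝ)) : Idx p q → CotFun V q
  | Sum.inl i => SmoothFun.mk (cotBody V) (fun y => y.2 i)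
      ((contDiff_apply ℝ ℝ i).comp contDiff_snd).contDiffOn ⊗ₜ[ℝ] 1
  | Sum.inr j => SuperFun.oddCoord (cotBody V) (Fin q ⊕ Fin q) (Sum.inr j)

/-- The partial derivative `∂/∂x^A` on the cotangent bundle. -/
def derivX (V : Opens (Fin p → ℝ)) : Idx p q → CotFun V q →ₗ[ℝ] CotFun V q
  | Sum.inl i => SuperFun.evenDeriv (cotBody V) _ (Pi.single i 1, 0)
  | Sum.inr j => SuperFun.oddDeriv (cotBody V) _ (Sum.inl j)

/-- The partial derivative `∂/∂p_A` on the cotangent bundle. -/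
def derivP (V : Opens (Fin p → ℝ)) : Idx p q → CotFun V q →ₗ[ℝ] CotFun V q
  | Sum.inl i => SuperFun.evenDeriv (cotBody V) _ (0, Pi.single i 1)
  | Sum.inr j => SuperFun.oddDeriv (cotBody V) _ (Sum.inr j)

/-- `F ↦ (-1)^{A F} F`, extended linearly to all `F`. -/
def twist (V : Opens (Fin p → ℝ)) : Idx p q → CotFun V q →ₗ[ℝ] CotFun V q
  | Sum.inl _ => LinearMap.id
  | Sum.inr _ => (SuperFun.involution (cotBody V) (Fin q ⊕ Fin q)).toLinearMap

/-- The canonical Poisson bracket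
`{F, G} = (-1)^{A F + A} ∂F/∂p_A ∂G/∂x^A - (-1)^{A F} ∂F/∂x^A ∂G/∂p_A`. -/
def poisson (V : Opens (Fin p → ℝ)) (F G : CotFun V q) : CotFun V q :=
  ∑ A : Idx p q,
    (sgn A.parity • (derivP V A (twist V A F) * derivX V A G)
      - derivX V A (twist V A F) * derivP V A G)

end Coordinates

/-! ### Supermanifolds -/

/-- A topological space with a sheaf of supercommutative real algebras. -/
structure SuperSpace where
  /-- The underlying space. -/
  X : TopCat.{u}
  /-- The structure sheaf. -/
  sheaf : TopCat.Sheaf (AlgCat.{u} ℝ) X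
  /-- The sections of parity `i`. -/
  parity : ∀ U : Opens X, ZMod 2 → Submodule ℝ (sheaf.1.obj (op U))
  isCompl_parity : ∀ U, IsCompl (parity U 0) (parity U 1)
  one_mem_parity : ∀ U, (1 : sheaf.1.obj (op U)) ∈ parity U 0
  mul_mem_parity : ∀ U i j (a b : sheaf.1.obj (op U)),
    a ∈ parity U i → b ∈ parity U j → a * b ∈ parity U (i + j)
  supercomm : ∀ U i j (a b : sheaf.1.obj (op U)),
    a ∈ parity U i → b ∈ parity U j → a * b = sgn (i * j) • (b * a)
  res_mem_parity : ∀ (U V : Opens X) (h : U ≤ V) i (a : sheaf.1.obj (op V)),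
    a ∈ parity V i → (sheaf.1.map (homOfLE h).op).hom a ∈ parity U i

namespace SuperSpace

variable (M : SuperSpace.{u})

/-- The superalgebra of functions on the open set `U`. -/
abbrev O (U : Opens M.X) : Type u := M.sheaf.1.obj (op U)

/-- Restriction of functions. -/
def res {U V : Opens M.X} (h : U ≤ V) : M.O V →ₐ[ℝ] M.O U :=
  (M.sheaf.1.map (homOfLE h).op).hom

theorem res_self {U : Opens M.X} (h : U ≤ U) (a : M.O U) : M.res h a = a := by
  simp [res]

theorem res_res {U V W : Opens M.X} (h : U ≤ V) (h' : V ≤ W) (a : M.O W) :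
    M.res h (M.res h' a) = M.res (h.trans h') a := by
  have : (homOfLE (h.trans h')).op = (homOfLE h').op ≫ (homOfLE h).op := rfl
  simp [res, this]

/-- Identification of the functions on two equal open sets. -/
def congr {U V : Opens M.X} (h : U = V) : M.O U ≃ₐ[ℝ] M.O V :=
  AlgEquiv.ofAlgHom (M.res h.ge) (M.res h.le)
    (by ext a; simp [res_res, res_self]) (by ext a; simp [res_res, res_self])

/-- The algebra `C^∞(M)` of global functions. -/
abbrev Functions : Type u := M.O ⊤

end SuperSpace

/-- The open set of points in the domain of `e` which `e` sends to `W`. -/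
def preimageOpen {X : TopCat.{u}} {p : ℕ} (e : OpenPartialHomeomorph X (Fin p → ℝ))
    (W : Opens (Fin p → ℝ)) : Opens X :=
  ⟨e.source ∩ e ⁻¹' W, e.isOpen_inter_preimage W.isOpen⟩

theorem preimageOpen_mono {X : TopCat.{u}} {p : ℕ} (e : OpenPartialHomeomorph X (Fin p → ℝ))
    {W W' : Opens (Fin p → ℝ)} (h : W' ≤ W) : preimageOpen e W' ≤ preimageOpen e W :=
  fun _ hx => ⟨hx.1, h hx.2⟩

/-- A chart of dimension `p|q`: an isomorphism, as spaces with a sheaf of superalgebras, of an open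
part of `M` with a superdomain. -/
structure SuperChart (M : SuperSpace.{u}) (p q : ℕ) where
  /-- The chart of the underlying spaces. -/
  e : OpenPartialHomeomorph M.X (Fin p → ℝ)
  /-- The isomorphism of structure sheaves. -/
  iso : ∀ W : Opens (Fin p → ℝ), (W : Set (Fin p → ℝ)) ⊆ e.target →
    (M.O (preimageOpen e W) ≃ₐ[ℝ] SuperFun W (Fin q))
  iso_res : ∀ (W W' : Opens (Fin p → ℝ)) (hW : (W : Set (Fin p → ℝ)) ⊆ e.target)
    (hW' : (W' : Set (Fin p → ℝ)) ⊆ e.target) (h : W' ≤ W) (a : M.O (preimageOpen e W)),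
    iso W' hW' (M.res (preimageOpen_mono e h) a) = SuperFun.res (Fin q) h (iso W hW a)
  iso_parity : ∀ (W : Opens (Fin p → ℝ)) (hW : (W : Set (Fin p → ℝ)) ⊆ e.target) (i : ZMod 2)
    (a : M.O (preimageOpen e W)),
    a ∈ M.parity _ i ↔ iso W hW a ∈ SuperFun.parity W (Fin q) i

namespace SuperChart

variable {M : SuperSpace.{u}} {p q : ℕ} (c : SuperChart M p q)

/-- The body of the superdomain onto which the chart maps. -/
def target : Opens (Fin p → ℝ) := ⟨c.e.target, c.e.open_target⟩

/-- The domain of the chart. -/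
def dom : Opens M.X := preimageOpen c.e c.target

/-- The expression in the coordinates of the chart of a function on its domain. -/
def read : M.O c.dom ≃ₐ[ℝ] SuperFun c.target (Fin q) := c.iso c.target subset_rfl

/-- The coordinate `x^A` of the chart, as a function on its domain. -/
def x (A : Idx p q) : M.O c.dom := c.read.symm (coord c.target A)

end SuperChart

/-- A supermanifold of dimension `p|q`. -/
class IsSupermanifold (M : SuperSpace.{u}) (p q : ℕ) : Prop where
  t2 : T2Space M.X
  secondCountable : SecondCountableTopology M.X
  exists_chart : ∀ m : M.X, ∃ c : SuperChart M p q, m ∈ c.dom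

/-- A diffeomorphism of supermanifolds: an isomorphism of spaces with a sheaf of superalgebras. -/
structure SuperDiffeo (M N : SuperSpace.{u}) where
  /-- The underlying homeomorphism. -/
  base : M.X ≃ₜ N.X
  /-- The pull-back of functions. -/
  pull : ∀ U : Opens N.X, N.O U ≃ₐ[ℝ] M.O (Opens.comap (base : C(M.X, N.X)) U)
  pull_res : ∀ (U V : Opens N.X) (h : U ≤ V) (a : N.O V),
    pull U (N.res h a) = M.res (Opens.comap_mono _ h) (pull V a)
  pull_parity : ∀ (U : Opens N.X) (i : ZMod 2) (a : N.O U),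
    a ∈ N.parity U i ↔ pull U a ∈ M.parity _ i

namespace SuperDiffeo

variable {M N : SuperSpace.{u}} {p q : ℕ} (φ : SuperDiffeo M N)

/-- The pull-back `φ^* f` of a global function. -/
def pullFun (f : N.Functions) : M.Functions := φ.pull ⊤ f

theorem comap_preimageOpen (e : OpenPartialHomeomorph M.X (Fin p → ℝ))
    (W : Opens (Fin p → ℝ)) :
    Opens.comap (φ.base : C(M.X, N.X))
      (preimageOpen (φ.base.symm.transOpenPartialHomeomorph e) W) = preimageOpen e W := by
  ext m
  simp [preimageOpen]

/-- Transport of a chart along a diffeomorphism: if `c` is the chart with coordinates `x^A`, this is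
the chart with coordinates `(φ⁻¹)^* x^A`. -/
def pushChart (c : SuperChart M p q) : SuperChart N p q where
  e := φ.base.symm.transOpenPartialHomeomorph c.e
  iso W hW := ((φ.pull _).trans (M.congr (φ.comap_preimageOpen c.e W))).trans (c.iso W hW)
  iso_res W W' hW hW' h a := by
    simp only [AlgEquiv.trans_apply]
    rw [← c.iso_res W W' hW hW' h, φ.pull_res _ _ (preimageOpen_mono _ h)]
    congr 1
    change M.res _ (M.res _ _) = M.res _ (M.res _ _)
    rw [SuperSpace.res_res, SuperSpace.res_res]
  iso_parity W hW i a := by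
    simp only [AlgEquiv.trans_apply]
    rw [← c.iso_parity W hW i, φ.pull_parity]
    constructor
    · intro h
      exact M.res_mem_parity _ _ _ i _ h
    · intro h
      have h' := M.res_mem_parity _ _ (φ.comap_preimageOpen c.e W).le i _ h
      change M.res _ (M.res _ _) ∈ _ at h'
      rwa [SuperSpace.res_res, SuperSpace.res_self] at h'

end SuperDiffeo

/-! ### Functions on the cotangent bundle -/

section Cotangent

variable {M : SuperSpace.{u}} {p q : ℕ}

/-- Families of expressions, one for each chart of `M`, in the natural coordinates `(x^A, p_A)` of
the cotangent bundle `T^*M`. -/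
abbrev CotFamily (M : SuperSpace.{u}) (p q : ℕ) : Type u :=
  ∀ c : SuperChart M p q, CotFun c.target q

/-- `Ψ` is the change of natural coordinates on `T^*M` between the chart `c` (coordinates `x^B`,
`p_B`) and a chart `c'` (coordinates `x'^A`, `p'_A`) with a smaller domain. It is the change of
coordinates of `M` on functions of `x`, and `p'_A = (∂x^B/∂x'^A) p_B`. -/
def IsCotTransition (c c' : SuperChart M p q) (h : c'.dom ≤ c.dom)
    (Ψ : CotFun c.target q →ₐ[ℝ] CotFun c'.target q) : Prop :=
  (∀ a : M.O c.dom, Ψ (toCot c.target q (c.read a)) = toCot c'.target q (c'.read (M.res h a))) ∧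
  ∀ A : Idx p q, mom c'.target A =
    ∑ B : Idx p q,
      toCot c'.target q (coordDeriv c'.target A (c'.read (M.res h (c.x B)))) *
        Ψ (mom c.target B)

/-- The family `F` is a function on `T^*M`: its local expressions agree under the changes of natural
coordinates. -/
def IsCotFunction (F : CotFamily M p q) : Prop :=
  ∀ (c c' : SuperChart M p q) (h : c'.dom ≤ c.dom),
    ∃ Ψ : CotFun c.target q →ₐ[ℝ] CotFun c'.target q,
      IsCotTransition c c' h Ψ ∧ Ψ (F c) = F c'

/-- `F` is odd. -/
def IsOddCot (F : CotFamily M p q) : Prop :=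
  ∀ c : SuperChart M p q, F c ∈ SuperFun.parity (cotBody c.target) (Fin q ⊕ Fin q) 1

/-- `F` has degree two in the fibre coordinates: `F = (1/2) F^{AB}(x) p_B p_A`. -/
def IsQuadraticCot (F : CotFamily M p q) : Prop :=
  ∀ c : SuperChart M p q, ∃ s : Idx p q → Idx p q → SuperFun c.target (Fin q),
    F c = (1 / 2 : ℝ) • ∑ A : Idx p q, ∑ B : Idx p q,
      toCot c.target q (s A B) * mom c.target B * mom c.target A

/-- The canonical Poisson bracket on `T^*M`. -/
def cotPoisson (F G : CotFamily M p q) : CotFamily M p q :=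
  fun c => poisson c.target (F c) (G c)

/-- A function on `M`, seen as a function on `T^*M`. -/
def cotLift (p q : ℕ) (f : M.Functions) : CotFamily M p q :=
  fun c => toCot c.target q (c.read (M.res le_top f))

/-- The pull-back `φ^* F` by the map of cotangent bundles which the diffeomorphism `φ` induces. This
map takes the natural coordinates `(x^A, p_A)` of a chart to those of the transported chart, so that
`φ^* F` has in the first chart the expression that `F` has in the second. -/
def SuperDiffeo.pullCot {N : SuperSpace.{u}} (φ : SuperDiffeo M N) (F : CotFamily N p q) :
    CotFamily M p q :=
  fun c => F (φ.pushChart c)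

/-- An odd vector field on `M`: an odd derivation of the structure sheaf. -/
structure OddVectorField (M : SuperSpace.{u}) where
  /-- The action on functions. -/
  act : ∀ U : Opens M.X, M.O U →ₗ[ℝ] M.O U
  act_res : ∀ (U V : Opens M.X) (h : U ≤ V) (a : M.O V),
    act U (M.res h a) = M.res h (act V a)
  act_parity : ∀ (U : Opens M.X) (i : ZMod 2) (a : M.O U),
    a ∈ M.parity U i → act U a ∈ M.parity U (i + 1)
  leibniz : ∀ (U : Opens M.X) (i : ZMod 2) (a b : M.O U), a ∈ M.parity U i →
    act U (a * b) = act U a * b + sgn i • (a * act U b)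

/-- The principal symbol `𝒬 = Q^A p_A` of the vector field `Q = Q^A ∂/∂x^A`; here
`Q^A = Q(x^A)`. -/
def OddVectorField.symbol (Q : OddVectorField M) (p q : ℕ) : CotFamily M p q :=
  fun c => ∑ A : Idx p q, toCot c.target q (c.read (Q.act c.dom (c.x A))) * mom c.target A

end Cotangent

/-! ### Odd Jacobi structures -/

/-- An odd Jacobi structure `(S, Q)`. The Lie derivative along `Q` of functions on `T^*M` is
`{𝒬, ·}`, with `𝒬` the symbol of `Q`. -/
structure OddJacobiStructure (M : SuperSpace.{u}) (p q : ℕ) where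
  /-- The almost Schouten structure. -/
  S : CotFamily M p q
  /-- The homological vector field. -/
  Q : OddVectorField M
  isCotFunction_S : IsCotFunction S
  isOdd_S : IsOddCot S
  isQuadratic_S : IsQuadraticCot S
  homological : ∀ (U : Opens M.X) (a : M.O U), Q.act U (Q.act U a) = 0
  invariance : cotPoisson (Q.symbol p q) S = 0
  compatibility : cotPoisson S S = (-2 : ℝ) • (Q.symbol p q * S)

namespace OddJacobiStructure

variable {M : SuperSpace.{u}} {p q : ℕ} (J : OddJacobiStructure M p q)

/-- The odd Jacobi bracket
`[f, g]_J = (-1)^(f+1) {{S, f}, g} - (-1)^(f+1) {𝒬, f g}` for `f` of parity `i`. -/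
def bracket (i : ZMod 2) (f g : M.Functions) : CotFamily M p q :=
  sgn (i + 1) • cotPoisson (cotPoisson J.S (cotLift p q f)) (cotLift p q g)
    - sgn (i + 1) • cotPoisson (J.Q.symbol p q) (cotLift p q (f * g))

/-- The Hamiltonian vector field `X_f(g) = (-1)^f [f, g]_J - Q(f) g` for `f` of parity `i`. -/
def hamiltonian (i : ZMod 2) (f g : M.Functions) : CotFamily M p q :=
  sgn i • J.bracket i f g - cotLift p q (J.Q.act ⊤ f * g)

/-- `φ^* [f, g]_J = [φ^* f, φ^* g]_J` for all functions `f`, `g`. -/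
def PreservesBracket (φ : SuperDiffeo M M) : Prop :=
  ∀ (i : ZMod 2) (f g : M.Functions), f ∈ M.parity ⊤ i →
    φ.pullCot (J.bracket i f g) = J.bracket i (φ.pullFun f) (φ.pullFun g)

/-- `X_f` and `X_{φ^* f}` are `φ`-related: `φ^* (X_f(g)) = X_{φ^* f}(φ^* g)` for all `g`. -/
def HamiltonianRelated (φ : SuperDiffeo M M) (i : ZMod 2) (f : M.Functions) : Prop :=
  ∀ g : M.Functions,
    φ.pullCot (J.hamiltonian i f g) = J.hamiltonian i (φ.pullFun f) (φ.pullFun g)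

end OddJacobiStructure

end OddJacobi

end

/-! The pair (S, 𝒬) can be recovered from its brackets with functions on M. Since {S, 1} = 0,
putting f = 1 gives [1, g]_J = {𝒬, g} = X_1(g), so the first and the third condition each imply that
φ^* respects the operation {𝒬, ·} on functions of M.

The key point is `eq_zero_of_poisson_toCot_eq_zero`. Let F be homogeneous of degree k ≠ 0 in the
momenta and Poisson commute with functions of the base. Bracketing with a function whose derivatives
at a point are those of x^A gives ∂F/∂p_A = 0 there, and Euler's identity p_A ∂F/∂p_A = kF then
forces F = 0. With k = 1 this applies to φ^*𝒬 - 𝒬 (`pullCot_symbol_eq`). Once 𝒬 is preserved, its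
terms cancel and leave φ^*{{S, f}, g} = {{S, φ^*f}, φ^*g}; using the criterion in degrees 2 and 1
gives φ^*S = S (`pullCot_quadratic_eq`). The global test functions come from bump functions and the
sheaf property (`SuperChart.exists_function`).

Conversely, φ^* commutes with the canonical bracket, so anything built from S, 𝒬 and brackets is
natural. The remaining term Q(f)g of X_f is covered by Q(f) = {𝒬, f} (`cotLift_act`), which rests on
the formula D = D(x^A) ∂/∂x^A for odd derivations and hence on Hadamard's lemma. -/

noncomputable section

namespace OddJacobi

/-! ### Smooth parametric integrals and Hadamard's lemma. -/

section Hadamard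

/-- The integral is the value at 0 of the convolution of the indicator of [-1, 0] with `F x`, and
convolution with a compactly supported factor depending smoothly on a parameter is smooth. -/
theorem contDiff_integral_of_contDiff {P : Type*} [NormedAddCommGroup P] [NormedSpace ℝ P]
    {F : P → ℝ → ℝ} (hF : ContDiff ℝ ∞ (Function.uncurry F)) :
    ContDiff ℝ ∞ (fun x => ∫ t in (0 : ℝ)..1, F x t) := by
  -- The cutoff supplies the compact support; it equals 1 on [-2, 2], so it does not change the
  -- values of `F x` on [0, 1].
  let b : ContDiffBump (0 : ℝ) := ⟨2, 3, by norm_num, by norm_num⟩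
  let f : ℝ → ℝ := Set.indicator (Set.Icc (-1) 0) 1
  have hf : MeasureTheory.LocallyIntegrable f MeasureTheory.volume := by
    refine (MeasureTheory.locallyIntegrable_const (1 : ℝ)).indicator measurableSet_Icc
  have key := MeasureTheory.contDiffOn_convolution_right_with_param_comp (n := ⊤)
    (μ := MeasureTheory.volume) (ContinuousLinearMap.mul ℝ ℝ) (s := (Set.univ : Set P))
    (v := fun _ => (0 : ℝ)) contDiffOn_const (f := f) (g := fun p t => b t * F p t)
    (k := Metric.closedBall 0 3) isOpen_univ (isCompact_closedBall 0 3)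
    (fun p x _ hx => by
      have : b x = 0 := b.zero_of_le_dist (by
        simp only [Metric.mem_closedBall, not_le] at hx; exact hx.le)
      simp [this]) hf
    (((b.contDiff.comp contDiff_snd).mul hF).contDiffOn)
  rw [contDiffOn_univ] at key
  convert! key using 1
  ext x
  symm
  rw [MeasureTheory.convolution_def]
  have h1 : ∀ t : ℝ, (ContinuousLinearMap.mul ℝ ℝ) (f t) (b (0 - t) * F x (0 - t))
      = Set.indicator (Set.Icc (-1 : ℝ) 0) (fun t => F x (-t)) t := by
    intro t
    by_cases ht : t ∈ Set.Icc (-1 : ℝ) 0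
    · have hb : b (-t) = 1 := b.one_of_mem_closedBall (by
        simp only [Metric.mem_closedBall, dist_zero_right, norm_neg, Real.norm_eq_abs]
        change |t| ≤ 2
        rw [abs_le]; constructor <;> linarith [ht.1, ht.2])
      simp [f, ht, hb]
    · simp [f, ht]
  simp_rw [h1]
  rw [MeasureTheory.integral_indicator measurableSet_Icc, MeasureTheory.integral_Icc_eq_integral_Ioc,
    ← intervalIntegral.integral_of_le (by norm_num), intervalIntegral.integral_comp_neg]
  simp

/-- Hadamard's lemma. -/
theorem exists_contDiff_eq_add_sum_mul {p : ℕ} {f : (Fin p → ℝ) → ℝ} (hf : ContDiff ℝ ∞ f)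
    (a : Fin p → ℝ) :
    ∃ g : Fin p → (Fin p → ℝ) → ℝ, (∀ i, ContDiff ℝ ∞ (g i)) ∧
      (∀ i, g i a = fderiv ℝ f a (Pi.single i 1)) ∧
      ∀ x, f x = f a + ∑ i, (x i - a i) * g i x := by
  have hd : ContDiff ℝ ∞ (fderiv ℝ f) := hf.fderiv_right (by simp)
  have hF (i : Fin p) : ContDiff ℝ ∞ (Function.uncurry fun (x : Fin p → ℝ) (t : ℝ) =>
      fderiv ℝ f (a + t • (x - a)) (Pi.single i 1)) := by
    refine (hd.comp ?_).clm_apply contDiff_const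
    exact contDiff_const.add (contDiff_snd.smul (contDiff_fst.sub contDiff_const))
  -- The witnesses average the partial derivatives over the segment from `a` to `x`; the expansion
  -- is the fundamental theorem of calculus along that segment.
  refine ⟨fun i x => ∫ t in (0 : ℝ)..1, fderiv ℝ f (a + t • (x - a)) (Pi.single i 1),
    fun i => contDiff_integral_of_contDiff (hF i), fun i => by simp, fun x => ?_⟩
  have hder : ∀ t : ℝ, HasDerivAt (fun t : ℝ => f (a + t • (x - a)))
      (fderiv ℝ f (a + t • (x - a)) (x - a)) t := by
    intro t
    have h1 : HasDerivAt (fun t : ℝ => a + t • (x - a)) (x - a) t := by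
      simpa using ((hasDerivAt_id t).smul_const (x - a)).const_add a
    exact (hf.differentiable (by simp) _).hasFDerivAt.comp_hasDerivAt t h1
  have hcont (v : Fin p → ℝ) : Continuous fun t : ℝ => fderiv ℝ f (a + t • (x - a)) v :=
    (hd.continuous.comp (by fun_prop)).clm_apply continuous_const
  have hftc := intervalIntegral.integral_eq_sub_of_hasDerivAt (fun t _ => hder t)
    ((hcont (x - a)).intervalIntegrable 0 1)
  simp only [one_smul, add_sub_cancel, zero_smul, add_zero] at hftc
  rw [← sub_eq_iff_eq_add', ← hftc]
  simp_rw [← intervalIntegral.integral_const_mul]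
  rw [← intervalIntegral.integral_finsetSum]
  · congr 1
    ext t
    have h := congrArg (fderiv ℝ f (a + t • (x - a))) (pi_eq_sum_univ' (x - a))
    simpa using h
  · intro i _
    exact ((hcont _).const_mul _).intervalIntegrable _ _

end Hadamard

/-! ### Sign rules in the Grassmann algebra. -/

section GrassmannAlgebra

variable {κ : Type}

/-- The parity involution of the Grassmann algebra. -/
abbrev Grassmann.involution (κ : Type) : Grassmann κ →ₐ[ℝ] Grassmann κ :=
  CliffordAlgebra.involute (Q := (0 : QuadraticForm ℝ (κ → ℝ)))

/-- Contraction of the Grassmann algebra with a covector. -/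
abbrev Grassmann.contract (d : (κ → ℝ) →ₗ[ℝ] ℝ) : Grassmann κ →ₗ[ℝ] Grassmann κ :=
  CliffordAlgebra.contractLeft (Q := (0 : QuadraticForm ℝ (κ → ℝ))) d

theorem Grassmann.induction {C : Grassmann κ → Prop} (one : C 1)
    (add : ∀ x y, C x → C y → C (x + y)) (smul : ∀ (r : ℝ) x, C x → C (r • x))
    (ι_mul : ∀ x v, C x → C (ExteriorAlgebra.ι ℝ v * x)) (x : Grassmann κ) : C x :=
  CliffordAlgebra.left_induction 0 (P := C)
    (fun r => by rw [Algebra.algebraMap_eq_smul_one]; exact smul r _ one) add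
    (fun x v h => ι_mul x v h) x

theorem Grassmann.involution_ι (v : κ → ℝ) :
    Grassmann.involution κ (ExteriorAlgebra.ι ℝ v) = -ExteriorAlgebra.ι ℝ v :=
  CliffordAlgebra.involute_ι v

theorem Grassmann.contract_ι_mul (d : (κ → ℝ) →ₗ[ℝ] ℝ) (v : κ → ℝ) (x : Grassmann κ) :
    Grassmann.contract d (ExteriorAlgebra.ι ℝ v * x)
      = d v • x - ExteriorAlgebra.ι ℝ v * Grassmann.contract d x :=
  CliffordAlgebra.contractLeft_ι_mul _ _ _

theorem Grassmann.contract_one (d : (κ → ℝ) →ₗ[ℝ] ℝ) : Grassmann.contract d 1 = 0 :=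
  CliffordAlgebra.contractLeft_one _ _

theorem Grassmann.contract_ι (d : (κ → ℝ) →ₗ[ℝ] ℝ) (v : κ → ℝ) :
    Grassmann.contract d (ExteriorAlgebra.ι ℝ v) = d v • 1 := by
  simpa [Grassmann.contract_one] using Grassmann.contract_ι_mul d v 1

theorem Grassmann.contract_mul (d : (κ → ℝ) →ₗ[ℝ] ℝ) (x y : Grassmann κ) :
    Grassmann.contract d (x * y)
      = Grassmann.contract d x * y + Grassmann.involution κ x * Grassmann.contract d y := by
  induction x using Grassmann.induction with
  | one => simp
  | add a b ha hb => simp only [add_mul, map_add, ha, hb]; abel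
  | smul r a ha => simp only [smul_mul_assoc, map_smul, ha, smul_add]
  | ι_mul a v ha =>
    rw [mul_assoc, Grassmann.contract_ι_mul, Grassmann.contract_ι_mul, ha, map_mul,
      Grassmann.involution_ι]
    simp only [sub_mul, mul_add, smul_mul_assoc, neg_mul, mul_assoc]
    abel

theorem Grassmann.involution_contract (d : (κ → ℝ) →ₗ[ℝ] ℝ) (x : Grassmann κ) :
    Grassmann.involution κ (Grassmann.contract d x)
      = -Grassmann.contract d (Grassmann.involution κ x) := by
  induction x using Grassmann.induction with
  | one => simp
  | add a b ha hb => simp only [map_add, ha, hb]; abel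
  | smul r a ha => simp only [map_smul, ha, smul_neg]
  | ι_mul a v ha =>
    rw [Grassmann.contract_ι_mul, map_mul, Grassmann.involution_ι, neg_mul, map_neg,
      Grassmann.contract_ι_mul, map_sub, map_smul, map_mul, Grassmann.involution_ι, ha]
    simp only [mul_neg, neg_mul, neg_neg]

/-- The involution carries the sign, so `x` need not be homogeneous. -/
theorem Grassmann.mul_ι (x : Grassmann κ) (v : κ → ℝ) :
    x * ExteriorAlgebra.ι ℝ v = ExteriorAlgebra.ι ℝ v * Grassmann.involution κ x := by
  induction x using Grassmann.induction with
  | one => simp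
  | add a b ha hb => simp only [add_mul, map_add, mul_add, ha, hb]
  | smul r a ha => simp only [map_smul, smul_mul_assoc, mul_smul_comm, ha]
  | ι_mul a w ha =>
    have h := eq_neg_of_add_eq_zero_right (ExteriorAlgebra.ι_add_mul_swap (R := ℝ) v w)
    rw [mul_assoc, ha, map_mul, Grassmann.involution_ι, neg_mul, mul_neg, ← mul_assoc, ← mul_assoc,
      h, neg_mul]

end GrassmannAlgebra

/-! ### Derivatives, signs and point evaluation of superfunctions. -/

section SuperFunAlgebra

variable {E : Type} [NormedAddCommGroup E] [NormedSpace ℝ E] {V : Opens E} {κ : Type}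

instance : Ring (SuperFun V κ) := Algebra.TensorProduct.instRing

instance : AddCommGroup (SuperFun V κ) := Ring.toAddCommGroup

instance : AddGroup (SuperFun V κ) := AddCommGroup.toAddGroup

theorem SmoothFun.deriv_apply (v : E) (f : SmoothFun V) (x : V) :
    (SmoothFun.deriv V v f).1 x = fderiv ℝ (zeroExt V f.1) x v := rfl

theorem SmoothFun.deriv_mul (v : E) (f g : SmoothFun V) :
    SmoothFun.deriv V v (f * g) = SmoothFun.deriv V v f * g + f * SmoothFun.deriv V v g := by
  ext x
  have hE : zeroExt V (f * g).1 = zeroExt V f.1 * zeroExt V g.1 := by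
    ext y
    by_cases hy : y ∈ V <;> simp [zeroExt, hy]
  change fderiv ℝ (zeroExt V (f * g).1) x v = fderiv ℝ (zeroExt V f.1) x v * g.1 x
    + f.1 x * fderiv ℝ (zeroExt V g.1) x v
  rw [hE, fderiv_mul (SmoothFun.differentiable f x) (SmoothFun.differentiable g x)]
  simp only [zeroExt_eq_of_mem V _ x.2, add_apply, smul_apply, smul_eq_mul]
  ring

theorem SmoothFun.deriv_one (v : E) : SmoothFun.deriv V v 1 = 0 := by
  simpa using SmoothFun.deriv_mul (V := V) v 1 1

theorem SuperFun.induction {C : SuperFun V κ → Prop} (tmul : ∀ f x, C (f ⊗ₜ x))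
    (add : ∀ F G, C F → C G → C (F + G)) (F : SuperFun V κ) : C F := by
  induction F using TensorProduct.induction_on with
  | zero => simpa using tmul 0 0
  | tmul f x => exact tmul f x
  | add F G hF hG => exact add F G hF hG

@[simp]
theorem SuperFun.involution_tmul (f : SmoothFun V) (x : Grassmann κ) :
    SuperFun.involution V κ (f ⊗ₜ x) = f ⊗ₜ Grassmann.involution κ x := rfl

@[simp]
theorem SuperFun.evenDeriv_tmul (v : E) (f : SmoothFun V) (x : Grassmann κ) :
    SuperFun.evenDeriv V κ v (f ⊗ₜ x) = SmoothFun.deriv V v f ⊗ₜ x := rfl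

@[simp]
theorem SuperFun.oddDeriv_tmul (j : κ) (f : SmoothFun V) (x : Grassmann κ) :
    SuperFun.oddDeriv V κ j (f ⊗ₜ x) = f ⊗ₜ Grassmann.contract (LinearMap.proj j) x := rfl

theorem SuperFun.involution_involution (F : SuperFun V κ) :
    SuperFun.involution V κ (SuperFun.involution V κ F) = F := by
  induction F using SuperFun.induction with
  | tmul f x => simp
  | add F G hF hG => simp only [map_add, hF, hG]

theorem SuperFun.evenDeriv_mul (v : E) (F G : SuperFun V κ) :
    SuperFun.evenDeriv V κ v (F * G)
      = SuperFun.evenDeriv V κ v F * G + F * SuperFun.evenDeriv V κ v G := by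
  induction F using SuperFun.induction with
  | add F F' hF hF' => simp only [add_mul, map_add, hF, hF']; abel
  | tmul f x =>
    induction G using SuperFun.induction with
    | add G G' hG hG' => simp only [mul_add, map_add, hG, hG']; abel
    | tmul g y =>
      simp [SmoothFun.deriv_mul, TensorProduct.add_tmul]

theorem SuperFun.oddDeriv_mul (j : κ) (F G : SuperFun V κ) :
    SuperFun.oddDeriv V κ j (F * G) = SuperFun.oddDeriv V κ j F * G
      + SuperFun.involution V κ F * SuperFun.oddDeriv V κ j G := by
  induction F using SuperFun.induction with
  | add F F' hF hF' => simp only [add_mul, map_add, hF, hF']; abel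
  | tmul f x =>
    induction G using SuperFun.induction with
    | add G G' hG hG' => simp only [mul_add, map_add, hG, hG']; abel
    | tmul g y =>
      simp [Grassmann.contract_mul, TensorProduct.tmul_add]

theorem SuperFun.involution_oddDeriv (j : κ) (F : SuperFun V κ) :
    SuperFun.involution V κ (SuperFun.oddDeriv V κ j F)
      = -SuperFun.oddDeriv V κ j (SuperFun.involution V κ F) := by
  induction F using SuperFun.induction with
  | add F F' hF hF' => simp only [map_add, hF, hF']; abel
  | tmul f x => simp [Grassmann.involution_contract, TensorProduct.tmul_neg]

theorem SuperFun.mul_tmul_one (F : SuperFun V κ) (f : SmoothFun V) :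
    F * f ⊗ₜ 1 = f ⊗ₜ 1 * F := by
  induction F using SuperFun.induction with
  | add F F' hF hF' => simp only [add_mul, mul_add, hF, hF']
  | tmul g x => simp [mul_comm]

theorem SuperFun.mul_oddCoord [DecidableEq κ] (F : SuperFun V κ) (j : κ) :
    F * SuperFun.oddCoord V κ j = SuperFun.oddCoord V κ j * SuperFun.involution V κ F := by
  induction F using SuperFun.induction with
  | add F F' hF hF' => simp only [add_mul, map_add, mul_add, hF, hF']
  | tmul g x => simp [SuperFun.oddCoord, Grassmann.mul_ι]

theorem SuperFun.involution_oddCoord [DecidableEq κ] (j : κ) :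
    SuperFun.involution V κ (SuperFun.oddCoord V κ j) = -SuperFun.oddCoord V κ j := by
  simp [SuperFun.oddCoord, TensorProduct.tmul_neg]

theorem SuperFun.oddDeriv_oddCoord [DecidableEq κ] (i j : κ) :
    SuperFun.oddDeriv V κ i (SuperFun.oddCoord V κ j) = if i = j then 1 else 0 := by
  rw [SuperFun.oddCoord, SuperFun.oddDeriv_tmul, Grassmann.contract_ι]
  by_cases h : i = j <;> simp [h, Algebra.TensorProduct.one_def]

theorem SuperFun.evenDeriv_oddCoord [DecidableEq κ] (v : E) (j : κ) :
    SuperFun.evenDeriv V κ v (SuperFun.oddCoord V κ j) = 0 := by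
  simp [SuperFun.oddCoord, SmoothFun.deriv_one]

theorem SuperFun.oddDeriv_tmul_one (j : κ) (f : SmoothFun V) :
    SuperFun.oddDeriv V κ j (f ⊗ₜ 1) = 0 := by
  simp

/-- Evaluation at a point of the body. -/
def SuperFun.eval (V : Opens E) (κ : Type) (x : V) : SuperFun V κ →ₐ[ℝ] Grassmann κ :=
  Algebra.TensorProduct.lift
    ((Algebra.ofId ℝ (Grassmann κ)).comp ((Pi.evalAlgHom ℝ (fun _ : V => ℝ) x).comp
      (SmoothFun V).val))
    (AlgHom.id ℝ (Grassmann κ)) (fun f y => Algebra.commutes (f.1 x) y)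

@[simp]
theorem SuperFun.eval_tmul (x : V) (f : SmoothFun V) (y : Grassmann κ) :
    SuperFun.eval V κ x (f ⊗ₜ y) = f.1 x • y := by
  rw [Algebra.smul_def]
  rfl

/-- A superfunction is determined by its values in the Grassmann algebra. -/
theorem SuperFun.ext_eval {F G : SuperFun V κ}
    (h : ∀ x, SuperFun.eval V κ x F = SuperFun.eval V κ x G) : F = G := by
  -- In a basis of the Grassmann algebra the coefficients are smooth functions on the body, and
  -- those are determined by their values.
  let b := Module.Free.chooseBasis ℝ (Grassmann κ)
  have key : ∀ (H : SuperFun V κ) (x : V) i,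
      (TensorProduct.equivFinsuppOfBasisRight b H i).1 x = b.repr (SuperFun.eval V κ x H) i := by
    intro H x i
    induction H using SuperFun.induction with
    | tmul f y => simp [mul_comm]
    | add F G hF hG => simp [← hF, ← hG]
  apply (TensorProduct.equivFinsuppOfBasisRight b).injective
  ext i x
  rw [key, key, h]

end SuperFunAlgebra

/-! ### Poisson bracket and Euler field in natural coordinates. -/

section CotangentCalculus

variable {p q : ℕ} {V : Opens (Fin p → ℝ)}

theorem sgn_zero : sgn 0 = 1 := by simp [sgn]

theorem sgn_one : sgn 1 = -1 := by simp [sgn, ZMod.val_one]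

theorem sgn_mul_self (i : ZMod 2) : sgn i * sgn i = 1 := by
  rw [sgn, ← mul_pow]; simp

theorem sgn_ne_zero (i : ZMod 2) : sgn i ≠ 0 :=
  left_ne_zero_of_mul_eq_one (sgn_mul_self i)

theorem twist_mul (A : Idx p q) (F G : CotFun V q) :
    twist V A (F * G) = twist V A F * twist V A G := by
  cases A
  · rfl
  · exact map_mul (SuperFun.involution _ _) F G

theorem twist_twist (A : Idx p q) (F : CotFun V q) : twist V A (twist V A F) = F := by
  cases A
  · rfl
  · exact SuperFun.involution_involution F

theorem twist_derivP (A : Idx p q) (F : CotFun V q) :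
    derivP V A (twist V A F) = sgn A.parity • twist V A (derivP V A F) := by
  cases A
  · exact ((congrArg (· • _) sgn_zero).trans (one_smul ℝ _)).symm
  · refine Eq.trans ?_ ((congrArg (· • _) sgn_one).trans (neg_one_smul ℝ _)).symm
    exact (neg_eq_iff_eq_neg.mpr (SuperFun.involution_oddDeriv _ F)).symm

theorem derivP_mul (A : Idx p q) (F G : CotFun V q) :
    derivP V A (F * G) = derivP V A F * G + twist V A F * derivP V A G := by
  cases A
  · exact SuperFun.evenDeriv_mul _ _ _
  · exact SuperFun.oddDeriv_mul _ _ _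

theorem mul_mom (A : Idx p q) (F : CotFun V q) :
    F * mom V A = mom V A * twist V A F := by
  cases A
  · exact SuperFun.mul_tmul_one _ _
  · exact SuperFun.mul_oddCoord _ _

theorem derivP_mom (A B : Idx p q) : derivP V A (mom V B) = if A = B then 1 else 0 := by
  rcases A with i | i <;> rcases B with j | j
  · simp only [derivP, mom, SuperFun.evenDeriv_tmul, Sum.inl.injEq]
    have : SmoothFun.deriv (cotBody V) ((0 : Fin p → ℝ), Pi.single i (1 : ℝ))
        (SmoothFun.mk (cotBody V) (fun y => y.2 j)
          ((contDiff_apply ℝ ℝ j).comp contDiff_snd).contDiffOn) = if i = j then 1 else 0 := by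
      ext x
      rw [SmoothFun.deriv_apply]
      have h : zeroExt (cotBody V) (SmoothFun.mk (cotBody V) (fun y => y.2 j)
          ((contDiff_apply ℝ ℝ j).comp contDiff_snd).contDiffOn).1 =ᶠ[nhds (x : _ × _)]
          ((ContinuousLinearMap.proj (R := ℝ) (φ := fun _ : Fin p => ℝ) j).comp
            (ContinuousLinearMap.snd ℝ (Fin p → ℝ) (Fin p → ℝ)) : _ × _ → ℝ) := by
        filter_upwards [(cotBody V).isOpen.mem_nhds x.2] with y hy
        exact zeroExt_eq_of_mem _ _ hy
      rw [h.fderiv_eq, ContinuousLinearMap.fderiv]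
      by_cases hij : i = j
      · subst hij; simp
      · simp [hij, Ne.symm hij]
    rw [this]
    by_cases hij : i = j <;> simp [hij, Algebra.TensorProduct.one_def]
  · simp only [derivP, mom, reduceCtorEq, if_false]
    exact SuperFun.evenDeriv_oddCoord _ _
  · simp only [derivP, mom, reduceCtorEq, if_false]
    exact SuperFun.oddDeriv_tmul_one _ _
  · simp only [derivP, mom, SuperFun.oddDeriv_oddCoord, Sum.inr.injEq]

/-- Only the fact that momenta are eigenvectors matters for counting degrees; the sign does not. -/
theorem twist_mom (A B : Idx p q) : ∃ r : ℝ, twist V A (mom V B) = r • mom V B := by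
  rcases A with i | i
  · exact ⟨1, (one_smul _ _).symm⟩
  · rcases B with j | j
    · exact ⟨1, by simp [twist, mom]⟩
    · exact ⟨-1, (SuperFun.involution_oddCoord _).trans (neg_one_smul ℝ _).symm⟩

@[simp]
theorem toCot_tmul (f : SmoothFun V) (x : Grassmann (Fin q)) :
    toCot V q (f ⊗ₜ x)
      = SmoothFun.comp V (cotBody V) Prod.fst contDiff_fst (fun _ hx => hx) f ⊗ₜ
        ExteriorAlgebra.map (LinearMap.pi (Sum.elim (fun j => LinearMap.proj j) (fun _ => 0)) :
          (Fin q → ℝ) →ₗ[ℝ] (Fin q ⊕ Fin q → ℝ)) x := rfl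

/-- For functions lifted to the cotangent bundle, the covector of an odd momentum composes with `L`
to zero, and that of an odd base coordinate composes to the same coordinate downstairs. -/
theorem contract_map {κ κ' : Type} (L : (κ → ℝ) →ₗ[ℝ] (κ' → ℝ)) (d : (κ' → ℝ) →ₗ[ℝ] ℝ)
    (x : Grassmann κ) :
    Grassmann.contract d (ExteriorAlgebra.map L x)
      = ExteriorAlgebra.map L (Grassmann.contract (d ∘ₗ L) x) := by
  induction x using Grassmann.induction with
  | one => simp
  | add a b ha hb => simp only [map_add, ha, hb]
  | smul r a ha => simp only [map_smul, ha]
  | ι_mul a v ha =>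
    rw [Grassmann.contract_ι_mul, map_mul, ExteriorAlgebra.map_apply_ι, Grassmann.contract_ι_mul,
      ha, map_sub, map_smul, map_mul, ExteriorAlgebra.map_apply_ι, LinearMap.comp_apply]

theorem contract_zero_left {κ : Type} (x : Grassmann κ) :
    Grassmann.contract (0 : (κ → ℝ) →ₗ[ℝ] ℝ) x = 0 := by
  simp

theorem SmoothFun.deriv_comp_fst (v w : Fin p → ℝ) (f : SmoothFun V) :
    SmoothFun.deriv (cotBody V) (v, w)
        (SmoothFun.comp V (cotBody V) Prod.fst contDiff_fst (fun _ hx => hx) f)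
      = SmoothFun.comp V (cotBody V) Prod.fst contDiff_fst (fun _ hx => hx)
          (SmoothFun.deriv V v f) := by
  ext x
  change fderiv ℝ (zeroExt V f.1 ∘ Prod.fst) x.1 (v, w) = fderiv ℝ (zeroExt V f.1) x.1.1 v
  rw [fderiv_comp (x : (Fin p → ℝ) × (Fin p → ℝ)) (SmoothFun.differentiable f (⟨x.1.1, x.2⟩ : V))
    differentiableAt_fst]
  simp [fderiv_fst]

theorem derivP_toCot (A : Idx p q) (f : SuperFun V (Fin q)) : derivP V A (toCot V q f) = 0 := by
  induction f using SuperFun.induction with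
  | add f g hf hg => simp only [map_add, hf, hg, add_zero]
  | tmul f x =>
    cases A with
    | inl i =>
      rw [toCot_tmul]
      refine (SuperFun.evenDeriv_tmul _ _ _).trans ?_
      rw [SmoothFun.deriv_comp_fst]
      have : SmoothFun.deriv V (0 : Fin p → ℝ) f = 0 := by
        ext x; simp [SmoothFun.deriv_apply]
      simp [this]
    | inr j =>
      rw [toCot_tmul]
      refine (SuperFun.oddDeriv_tmul _ _ _).trans ?_
      rw [contract_map]
      have : (LinearMap.proj (Sum.inr j) : (Fin q ⊕ Fin q → ℝ) →ₗ[ℝ] ℝ) ∘ₗ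
        (LinearMap.pi (Sum.elim (fun j => LinearMap.proj j) (fun _ => 0)) :
          (Fin q → ℝ) →ₗ[ℝ] (Fin q ⊕ Fin q → ℝ)) = 0 := by ext; simp
      rw [this, contract_zero_left, map_zero, TensorProduct.tmul_zero]

theorem derivX_toCot (A : Idx p q) (f : SuperFun V (Fin q)) :
    derivX V A (toCot V q f) = toCot V q (coordDeriv V A f) := by
  induction f using SuperFun.induction with
  | add f g hf hg => simp only [map_add, hf, hg]
  | tmul f x =>
    cases A with
    | inl i =>
      rw [toCot_tmul]
      refine (SuperFun.evenDeriv_tmul _ _ _).trans ?_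
      rw [SmoothFun.deriv_comp_fst]
      rfl
    | inr j =>
      rw [toCot_tmul]
      refine (SuperFun.oddDeriv_tmul _ _ _).trans ?_
      rw [contract_map]
      have : (LinearMap.proj (Sum.inl j) : (Fin q ⊕ Fin q → ℝ) →ₗ[ℝ] ℝ) ∘ₗ
        (LinearMap.pi (Sum.elim (fun j => LinearMap.proj j) (fun _ => 0)) :
          (Fin q → ℝ) →ₗ[ℝ] (Fin q ⊕ Fin q → ℝ)) = LinearMap.proj j := by ext; simp
      rw [this]
      rfl

theorem eval_toCot (y : cotBody V) (f : SuperFun V (Fin q)) :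
    SuperFun.eval (cotBody V) (Fin q ⊕ Fin q) y (toCot V q f)
      = ExteriorAlgebra.map (LinearMap.pi (Sum.elim (fun j => LinearMap.proj j) (fun _ => 0)) :
          (Fin q → ℝ) →ₗ[ℝ] (Fin q ⊕ Fin q → ℝ))
        (SuperFun.eval V (Fin q) ⟨y.1.1, y.2⟩ f) := by
  induction f using SuperFun.induction with
  | add f g hf hg => simp only [map_add, hf, hg]
  | tmul f x =>
    rw [toCot_tmul, SuperFun.eval_tmul, SuperFun.eval_tmul, map_smul]
    rfl

theorem poisson_toCot (F : CotFun V q) (f : SuperFun V (Fin q)) :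
    poisson V F (toCot V q f)
      = ∑ A : Idx p q, sgn A.parity • (derivP V A (twist V A F) * toCot V q (coordDeriv V A f)) := by
  simp only [poisson, derivP_toCot, derivX_toCot, mul_zero, sub_zero]

theorem poisson_sub_left (F G H : CotFun V q) :
    poisson V (F - G) H = poisson V F H - poisson V G H := by
  rw [poisson, poisson, poisson, ← Finset.sum_sub_distrib]
  refine Finset.sum_congr rfl fun _ _ => ?_
  simp only [map_sub, sub_mul, smul_sub]
  abel

/-- The Euler vector field `p_A ∂/∂p_A` on the cotangent bundle. -/
def euler (V : Opens (Fin p → ℝ)) (q : ℕ) : CotFun V q →ₗ[ℝ] CotFun V q :=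
  ∑ A : Idx p q, LinearMap.mulLeft ℝ (mom V A) ∘ₗ derivP V A

theorem euler_apply (F : CotFun V q) : euler V q F = ∑ A, mom V A * derivP V A F := by
  simp [euler]

/-- The Leibniz rule carries no sign: the twist produced by `derivP_mul` is undone by moving `F`
past the momentum with `mul_mom`. -/
theorem euler_mul (F G : CotFun V q) :
    euler V q (F * G) = euler V q F * G + F * euler V q G := by
  simp only [euler_apply, derivP_mul, mul_add, Finset.sum_add_distrib, Finset.sum_mul,
    Finset.mul_sum, ← mul_assoc, mul_mom]

theorem euler_toCot (f : SuperFun V (Fin q)) : euler V q (toCot V q f) = 0 := by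
  simp [euler_apply, derivP_toCot]

theorem euler_mom (A : Idx p q) : euler V q (mom V A) = mom V A := by
  simp [euler_apply, derivP_mom]

theorem euler_quadratic (s : Idx p q → Idx p q → SuperFun V (Fin q)) :
    euler V q ((1 / 2 : ℝ) • ∑ A, ∑ B, toCot V q (s A B) * mom V B * mom V A)
      = (2 : ℝ) • ((1 / 2 : ℝ) • ∑ A, ∑ B, toCot V q (s A B) * mom V B * mom V A) := by
  simp only [map_smul, map_sum, euler_mul, euler_toCot, euler_mom, zero_mul, zero_add, ← two_smul ℝ,
    ← Finset.smul_sum]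
  rw [smul_comm]

theorem euler_linear (s : Idx p q → SuperFun V (Fin q)) :
    euler V q (∑ A, toCot V q (s A) * mom V A) = ∑ A, toCot V q (s A) * mom V A := by
  simp only [map_sum, euler_mul, euler_toCot, euler_mom, zero_mul, zero_add]

/-- A momentum derivative removes one of the two momenta, and the twist only rescales momenta, so
what is left has degree one. -/
theorem euler_derivP_quadratic (s : Idx p q → Idx p q → SuperFun V (Fin q)) (C : Idx p q) :
    euler V q (derivP V C (twist V C
        ((1 / 2 : ℝ) • ∑ A, ∑ B, toCot V q (s A B) * mom V B * mom V A)))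
      = derivP V C (twist V C
        ((1 / 2 : ℝ) • ∑ A, ∑ B, toCot V q (s A B) * mom V B * mom V A)) := by
  simp only [map_smul, map_sum]
  congr 1
  refine Finset.sum_congr rfl fun A _ => Finset.sum_congr rfl fun B _ => ?_
  obtain ⟨a, ha⟩ := twist_mom (V := V) C A
  obtain ⟨b, hb⟩ := twist_mom (V := V) C B
  have h : derivP V C (twist V C (toCot V q (s A B))) = 0 := by
    rw [twist_derivP, derivP_toCot, map_zero, smul_zero]
  have h1 : euler V q (1 : CotFun V q) = 0 := by
    rw [← map_one (toCot V q), euler_toCot]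
  simp only [twist_mul, derivP_mul, h, twist_twist, ha, hb, map_smul, derivP_mom, zero_mul, zero_add,
    map_add, euler_mul, euler_toCot, euler_mom]
  congr 1
  · split_ifs
    · rw [h1, smul_zero, mul_zero, zero_mul, zero_add]
    · simp only [smul_zero, mul_zero, zero_mul, map_zero, add_zero]
  · split_ifs
    · rw [h1, smul_zero, mul_zero, add_zero]
    · simp only [smul_zero, mul_zero, map_zero, add_zero]

theorem euler_poisson_toCot_quadratic (s : Idx p q → Idx p q → SuperFun V (Fin q))
    (f : SuperFun V (Fin q)) :
    euler V q (poisson V ((1 / 2 : ℝ) • ∑ A, ∑ B, toCot V q (s A B) * mom V B * mom V A)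
        (toCot V q f))
      = poisson V ((1 / 2 : ℝ) • ∑ A, ∑ B, toCot V q (s A B) * mom V B * mom V A)
        (toCot V q f) := by
  rw [poisson_toCot, map_sum]
  refine Finset.sum_congr rfl fun C _ => ?_
  rw [map_smul, euler_mul, euler_toCot, euler_derivP_quadratic, mul_zero, add_zero]

/-- A fibrewise homogeneous function of nonzero degree on the cotangent bundle vanishes if it
Poisson commutes with enough functions of the base. -/
theorem eq_zero_of_poisson_toCot_eq_zero {F : CotFun V q} {k : ℝ} (hk : k ≠ 0)
    (hF : euler V q F = k • F) {T : Set (SuperFun V (Fin q))}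
    (hT : ∀ (A : Idx p q) (x : V), ∃ f ∈ T, ∀ B,
      SuperFun.eval V (Fin q) x (coordDeriv V B f) = if B = A then 1 else 0)
    (h : ∀ f ∈ T, poisson V F (toCot V q f) = 0) : F = 0 := by
  have hd : ∀ A, derivP V A (twist V A F) = 0 := by
    intro A
    refine SuperFun.ext_eval fun y => ?_
    -- At a point of the fibre over this base point, only the summand with index `A` of the bracket
    -- survives.
    obtain ⟨f, hfT, hf⟩ := hT A ⟨y.1.1, y.2⟩
    have h' := congrArg (SuperFun.eval (cotBody V) (Fin q ⊕ Fin q) y) (h f hfT)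
    rw [poisson_toCot, map_sum, Finset.sum_eq_single A] at h'
    · rw [map_smul, map_mul, eval_toCot, hf, if_pos rfl, map_one, mul_one, map_zero] at h'
      rw [map_zero]
      exact (smul_eq_zero.mp h').resolve_left (sgn_ne_zero _)
    · intro B _ hB
      rw [map_smul, map_mul, eval_toCot, hf, if_neg hB, map_zero, mul_zero, smul_zero]
    · simp
  -- The twist is an involution and commutes with the derivative up to sign, so it can be removed.
  have hd' : ∀ A, derivP V A F = 0 := by
    intro A
    have := hd A
    rw [twist_derivP] at this
    rw [← twist_twist A (derivP V A F), (smul_eq_zero.mp this).resolve_left (sgn_ne_zero _),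
      map_zero]
  rw [euler_apply] at hF
  simp only [hd', mul_zero, Finset.sum_const_zero] at hF
  exact (smul_eq_zero.mp hF.symm).resolve_left hk

end CotangentCalculus

/-! ### Odd derivations of superfunctions in coordinates. -/

section Derivations

theorem SuperFun.induction_generators {E : Type} [NormedAddCommGroup E] [NormedSpace ℝ E]
    {V : Opens E} {κ : Type} [Finite κ] [DecidableEq κ] {C : SuperFun V κ → Prop}
    (tmul_one : ∀ f, C (f ⊗ₜ 1)) (oddCoord : ∀ j, C (SuperFun.oddCoord V κ j))
    (add : ∀ F G, C F → C G → C (F + G)) (mul : ∀ F G, C F → C G → C (F * G))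
    (F : SuperFun V κ) : C F := by
  have := Fintype.ofFinite κ
  have hι : ∀ v : κ → ℝ, C (1 ⊗ₜ ExteriorAlgebra.ι ℝ v) := by
    intro v
    have : (1 ⊗ₜ ExteriorAlgebra.ι ℝ v : SuperFun V κ)
        = ∑ j, (v j • (1 : SmoothFun V)) ⊗ₜ 1 * SuperFun.oddCoord V κ j := by
      conv_lhs => rw [pi_eq_sum_univ' v]
      simp only [map_sum, TensorProduct.tmul_sum, map_smul, SuperFun.oddCoord,
        Algebra.TensorProduct.tmul_mul_tmul, mul_one, TensorProduct.smul_tmul, smul_mul_assoc, one_mul]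
    rw [this]
    refine Finset.sum_induction _ C (fun a b => add a b) ?_ fun j _ =>
      mul _ _ (tmul_one _) (oddCoord j)
    have h0 := tmul_one 0
    rwa [TensorProduct.zero_tmul] at h0
  have hx : ∀ x : Grassmann κ, C (1 ⊗ₜ x) := by
    intro x
    induction x using Grassmann.induction with
    | one => exact tmul_one 1
    | add x y hx hy => rw [TensorProduct.tmul_add]; exact add _ _ hx hy
    | smul r x hx =>
      have := mul _ _ (tmul_one (r • 1)) hx
      rwa [Algebra.TensorProduct.tmul_mul_tmul, one_mul, mul_one, TensorProduct.smul_tmul] at this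
    | ι_mul x v hx =>
      have := mul _ _ (hι v) hx
      rwa [Algebra.TensorProduct.tmul_mul_tmul, one_mul] at this
  induction F using SuperFun.induction with
  | add F G hF hG => exact add F G hF hG
  | tmul f x =>
    have := mul _ _ (tmul_one f) (hx x)
    rwa [Algebra.TensorProduct.tmul_mul_tmul, one_mul, mul_one] at this

section Supercommutativity

variable {E : Type} [NormedAddCommGroup E] [NormedSpace ℝ E] {V : Opens E} {κ : Type} [Finite κ]

/-- Only `Y` has to be homogeneous: the identity passes to sums and products in `F`, so it suffices
to check generators. The odd case below works in the same way. -/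
theorem SuperFun.mul_comm_of_mem_parity_zero {Y : SuperFun V κ} (hY : Y ∈ SuperFun.parity V κ 0)
    (F : SuperFun V κ) : Y * F = F * Y := by
  classical
  have hY' : SuperFun.involution V κ Y = Y := by
    refine Eq.trans hY ?_
    rw [sgn_zero, one_smul]
  induction F using SuperFun.induction_generators with
  | tmul_one f => exact SuperFun.mul_tmul_one Y f
  | oddCoord j => rw [SuperFun.mul_oddCoord, hY']
  | add F G hF hG => rw [mul_add, add_mul, hF, hG]
  | mul F G hF hG => rw [← mul_assoc, hF, mul_assoc, hG, mul_assoc]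

theorem SuperFun.mul_comm_of_mem_parity_one {Y : SuperFun V κ} (hY : Y ∈ SuperFun.parity V κ 1)
    (F : SuperFun V κ) : Y * F = SuperFun.involution V κ F * Y := by
  classical
  have hY' : SuperFun.involution V κ Y = -Y := by
    refine Eq.trans hY ?_
    rw [sgn_one, neg_smul, one_smul]
  induction F using SuperFun.induction_generators with
  | tmul_one f => rw [SuperFun.mul_tmul_one, SuperFun.involution_tmul, map_one]
  | oddCoord j => rw [SuperFun.mul_oddCoord, hY', SuperFun.involution_oddCoord, mul_neg, neg_mul]
  | add F G hF hG => rw [mul_add, map_add, add_mul, hF, hG]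
  | mul F G hF hG => rw [← mul_assoc, hF, mul_assoc, hG, map_mul, mul_assoc]

end Supercommutativity

theorem exists_contDiffBump {p : ℕ} (V : Opens (Fin p → ℝ)) (a : V) :
    ∃ χ : ContDiffBump (a : Fin p → ℝ), Metric.closedBall (a : Fin p → ℝ) χ.rOut ⊆ V := by
  obtain ⟨r, hr, h⟩ := Metric.nhds_basis_closedBall.mem_iff.mp (V.isOpen.mem_nhds a.2)
  exact ⟨⟨r / 2, r, by positivity, by linarith⟩, h⟩

/-- A smooth function on an open set agrees near a given point with a globally smooth one. -/
theorem SmoothFun.exists_contDiff_extension {p : ℕ} {V : Opens (Fin p → ℝ)} (f : SmoothFun V)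
    (a : V) : ∃ F : (Fin p → ℝ) → ℝ, ContDiff ℝ ∞ F ∧ zeroExt V f.1 =ᶠ[nhds (a : Fin p → ℝ)] F := by
  obtain ⟨χ, hχ⟩ := exists_contDiffBump V a
  refine ⟨fun x => χ x * zeroExt V f.1 x, contDiff_iff_contDiffAt.mpr fun x => ?_, ?_⟩
  · by_cases hx : x ∈ V
    · exact χ.contDiff.contDiffAt.mul (f.2.contDiffAt (V.isOpen.mem_nhds hx))
    · have h : (fun x => χ x * zeroExt V f.1 x) =ᶠ[nhds x] fun _ => 0 := by
        filter_upwards [Metric.isClosed_closedBall.isOpen_compl.mem_nhds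
          (show x ∈ (Metric.closedBall (a : Fin p → ℝ) χ.rOut)ᶜ from fun h => hx (hχ h))] with y hy
        rw [χ.zero_of_le_dist (not_le.mp fun h => hy h).le, zero_mul]
      exact contDiffAt_const.congr_of_eventuallyEq h
  · filter_upwards [χ.eventuallyEq_one] with x hx
    simp [hx]

variable {p q : ℕ} {V : Opens (Fin p → ℝ)}

theorem coordDeriv_inl_mul (i : Fin p) (F G : SuperFun V (Fin q)) :
    coordDeriv V (Sum.inl i) (F * G)
      = coordDeriv V (Sum.inl i) F * G + F * coordDeriv V (Sum.inl i) G :=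
  SuperFun.evenDeriv_mul _ _ _

theorem coordDeriv_inr_mul (j : Fin q) (F G : SuperFun V (Fin q)) :
    coordDeriv V (Sum.inr j) (F * G) = coordDeriv V (Sum.inr j) F * G
      + SuperFun.involution V (Fin q) F * coordDeriv V (Sum.inr j) G :=
  SuperFun.oddDeriv_mul _ _ _

theorem coordDeriv_coord (A B : Idx p q) :
    coordDeriv V A (coord V B) = if A = B then 1 else 0 := by
  rcases A with i | i <;> rcases B with j | j
  · simp only [coordDeriv, coord, SuperFun.evenDeriv_tmul, Sum.inl.injEq]
    have : SmoothFun.deriv V (Pi.single i (1 : ℝ))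
        (SmoothFun.mk V (fun x => x j) (contDiff_apply ℝ ℝ j).contDiffOn)
          = if i = j then 1 else 0 := by
      ext x
      rw [SmoothFun.deriv_apply]
      have h : zeroExt V (SmoothFun.mk V (fun x => x j) (contDiff_apply ℝ ℝ j).contDiffOn).1
          =ᶠ[nhds (x : Fin p → ℝ)]
          (ContinuousLinearMap.proj (R := ℝ) (φ := fun _ : Fin p => ℝ) j : (Fin p → ℝ) → ℝ) := by
        filter_upwards [V.isOpen.mem_nhds x.2] with y hy
        exact zeroExt_eq_of_mem _ _ hy
      rw [h.fderiv_eq, ContinuousLinearMap.fderiv]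
      by_cases hij : i = j
      · subst hij; simp
      · simp [hij, Ne.symm hij]
    rw [this]
    by_cases hij : i = j <;> simp [hij, Algebra.TensorProduct.one_def]
  · simp only [coordDeriv, coord, reduceCtorEq, if_false]
    exact SuperFun.evenDeriv_oddCoord _ _
  · simp only [coordDeriv, coord, reduceCtorEq, if_false]
    exact SuperFun.oddDeriv_tmul_one _ _
  · simp only [coordDeriv, coord, SuperFun.oddDeriv_oddCoord, Sum.inr.injEq]

/-- An odd derivation of superfunctions is determined on functions of the even coordinates by its
values on these coordinates. -/
theorem derivation_tmul_one {D : SuperFun V (Fin q) →ₗ[ℝ] SuperFun V (Fin q)}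
    (hD : ∀ F G, D (F * G) = D F * G + SuperFun.involution V (Fin q) F * D G) (f : SmoothFun V) :
    D (f ⊗ₜ 1) = ∑ i, D (coord V (Sum.inl i)) * (SmoothFun.deriv V (Pi.single i 1) f ⊗ₜ 1) := by
  refine SuperFun.ext_eval fun a => ?_
  -- Evaluated at `a`, the derivation becomes a Grassmann-valued point derivation. It kills
  -- constants and products of two functions vanishing at `a`.
  let δ : SmoothFun V →ₗ[ℝ] Grassmann (Fin q) :=
    (SuperFun.eval V (Fin q) a).toLinearMap ∘ₗ D ∘ₗ
      (TensorProduct.mk ℝ (SmoothFun V) (Grassmann (Fin q))).flip 1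
  have hδ (f : SmoothFun V) : δ f = SuperFun.eval V (Fin q) a (D (f ⊗ₜ 1)) := rfl
  have hmul (f g : SmoothFun V) : δ (f * g) = g.1 a • δ f + f.1 a • δ g := by
    have : ((f * g) ⊗ₜ 1 : SuperFun V (Fin q)) = f ⊗ₜ 1 * g ⊗ₜ 1 := by simp
    simp only [hδ, this, hD, map_add, map_mul, SuperFun.involution_tmul, map_one,
      SuperFun.eval_tmul, smul_mul_assoc, one_mul, mul_smul_comm, mul_one]
  have hone : δ 1 = 0 := by
    have := hmul 1 1
    simpa using this
  have hzero {f g : SmoothFun V} (hf : f.1 a = 0) (hg : g.1 a = 0) : δ (f * g) = 0 := by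
    rw [hmul, hf, hg, zero_smul, zero_smul, add_zero]
  obtain ⟨F, hF, hFf⟩ := SmoothFun.exists_contDiff_extension f a
  have hlocal : δ f = δ (SmoothFun.mk V F hF.contDiffOn) := by
    obtain ⟨ε, hε, hball⟩ := Metric.eventually_nhds_iff_ball.mp hFf
    let ψ : ContDiffBump (a : Fin p → ℝ) := ⟨ε / 2, ε, by positivity, by linarith⟩
    have hψ : ∀ x : V, ψ x * (f.1 x - F x) = 0 := by
      intro x
      by_cases hx : (x : Fin p → ℝ) ∈ Metric.ball (a : Fin p → ℝ) ε
      · have := hball x hx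
        rw [zeroExt_eq_of_mem V _ x.2] at this
        rw [this, sub_self, mul_zero]
      · rw [ψ.zero_of_le_dist (not_lt.mp hx), zero_mul]
    -- As ψ is supported where `f` and `F` agree, the difference f - F equals (1 - ψ)(f - F), a
    -- product of two functions vanishing at `a`. Hence δ depends only on the germ.
    have h : f = SmoothFun.mk V F hF.contDiffOn
        + (1 - SmoothFun.mk V ψ ψ.contDiff.contDiffOn) * (f - SmoothFun.mk V F hF.contDiffOn) := by
      ext x
      change f.1 x = F x + (1 - ψ x) * (f.1 x - F x)
      linear_combination hψ x
    have ha : f.1 a = F a := by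
      rw [← hFf.self_of_nhds, zeroExt_eq_of_mem V _ a.2]
    rw [h, map_add, hzero, add_zero]
    · change 1 - ψ a = 0
      rw [ψ.one_of_mem_closedBall (Metric.mem_closedBall_self ψ.rIn_pos.le), sub_self]
    · change f.1 a - F a = 0
      rw [ha, sub_self]
  obtain ⟨g, hg, hga, hsum⟩ := exists_contDiff_eq_add_sum_mul hF (a : Fin p → ℝ)
  -- Hadamard's expansion at `a`, read in the algebra of smooth functions so that δ can be applied
  -- term by term.
  have hdec : SmoothFun.mk V F hF.contDiffOn = F a • 1 + ∑ i,
      (SmoothFun.mk V (fun x => x i) (contDiff_apply ℝ ℝ i).contDiffOn - (a : Fin p → ℝ) i • 1)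
        * SmoothFun.mk V (g i) (hg i).contDiffOn := by
    ext x
    let e : SmoothFun V →ₐ[ℝ] ℝ := (Pi.evalAlgHom ℝ (fun _ : V => ℝ) x).comp (SmoothFun V).val
    have he (f : SmoothFun V) : f.1 x = e f := rfl
    refine (he _).trans (Eq.trans ?_ (he _).symm)
    simp only [map_add, map_sum, map_mul, map_smul, map_sub, map_one]
    change F x = F a * 1 + ∑ i, ((x : Fin p → ℝ) i - (a : Fin p → ℝ) i * 1) * g i x
    simp only [mul_one]
    exact hsum x
  have hcoord (i : Fin p) : δ (SmoothFun.mk V (fun x => x i) (contDiff_apply ℝ ℝ i).contDiffOn)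
      = SuperFun.eval V (Fin q) a (D (coord V (Sum.inl i))) := rfl
  rw [← hδ, hlocal, hdec]
  simp only [map_add, map_sum, map_smul, map_mul, map_sub, hone, smul_zero, zero_add, sub_zero,
    hmul, hcoord, SuperFun.eval_tmul]
  refine Finset.sum_congr rfl fun i _ => ?_
  have h0 : (SmoothFun.mk V (fun x => x i) (contDiff_apply ℝ ℝ i).contDiffOn
      - (a : Fin p → ℝ) i • (1 : SmoothFun V)).1 a = 0 := by
    change (a : Fin p → ℝ) i - (a : Fin p → ℝ) i * 1 = 0
    rw [mul_one, sub_self]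
  rw [h0, zero_smul, add_zero, mul_smul_comm, mul_one]
  congr 1
  rw [SmoothFun.deriv_apply, hFf.fderiv_eq]
  exact hga i

/-- An odd derivation of superfunctions has the form `D = D(x^A) ∂/∂x^A`. -/
theorem derivation_eq_sum {D : SuperFun V (Fin q) →ₗ[ℝ] SuperFun V (Fin q)}
    (hD : ∀ F G, D (F * G) = D F * G + SuperFun.involution V (Fin q) F * D G)
    (hpar : ∀ A, D (coord V A) ∈ SuperFun.parity V (Fin q) (A.parity + 1))
    (F : SuperFun V (Fin q)) :
    D F = ∑ A, D (coord V A) * coordDeriv V A F := by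
  induction F using SuperFun.induction_generators with
  | tmul_one f =>
    rw [derivation_tmul_one hD, Fintype.sum_sum_type]
    have h : ∀ j : Fin q, coordDeriv V (Sum.inr j) (f ⊗ₜ 1) = 0 := fun j =>
      SuperFun.oddDeriv_tmul_one _ _
    simp only [h, mul_zero, Finset.sum_const_zero, add_zero]
    rfl
  | oddCoord j =>
    change D (coord V (Sum.inr j)) = ∑ A, D (coord V A) * coordDeriv V A (coord V (Sum.inr j))
    simp only [coordDeriv_coord, mul_ite, mul_one, mul_zero, Finset.sum_ite_eq',
      Finset.mem_univ, if_true]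
  | add F G hF hG => simp only [map_add, mul_add, Finset.sum_add_distrib, hF, hG]
  | mul F G hF hG =>
    rw [hD, hF, hG, Finset.sum_mul, Finset.mul_sum, ← Finset.sum_add_distrib]
    refine Finset.sum_congr rfl fun A _ => ?_
    -- Each summand must itself be an odd derivation. For an even coordinate the coefficient is odd
    -- and supplies the involution of `F`; for an odd coordinate the coefficient is even and the
    -- involution comes from the derivative.
    rcases A with i | j
    · rw [coordDeriv_inl_mul, mul_add, ← mul_assoc, ← mul_assoc, ← mul_assoc,
        SuperFun.mul_comm_of_mem_parity_one (hpar (Sum.inl i)) F]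
    · rw [coordDeriv_inr_mul, mul_add, ← mul_assoc, ← mul_assoc, ← mul_assoc,
        SuperFun.mul_comm_of_mem_parity_zero (hpar (Sum.inr j)) (SuperFun.involution V (Fin q) F)]

end Derivations

/-! ### Global test functions, and vector fields as brackets with their symbols. -/

section Gluing

namespace SuperSpace

variable (M : SuperSpace.{u})

/-- Extension by zero: a function on `U` which vanishes on `U ⊓ W` extends to `U ⊔ W = ⊤`. -/
theorem exists_extension {U W : Opens M.X} (hUW : U ⊔ W = ⊤) (s : M.O U)
    (hs : M.res (inf_le_left : U ⊓ W ≤ U) s = 0) :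
    ∃ f : M.Functions, M.res le_top f = s := by
  let cover : Bool → Opens M.X := fun b => cond b U W
  let sf : ∀ b, M.O (cover b) := fun b => match b with
    | true => s
    | false => 0
  obtain ⟨f, hf, -⟩ := M.sheaf.existsUnique_gluing' cover ⊤ (fun b => homOfLE le_top)
    (by rw [← hUW]; exact sup_le (le_iSup cover true) (le_iSup cover false)) sf
    (by
      intro i j
      cases i <;> cases j
      · rfl
      · change M.res _ (0 : M.O W) = M.res (_ : W ⊓ U ≤ U) s
        have h := congrArg (M.res (le_of_eq (inf_comm W U))) hs
        rw [res_res, map_zero] at h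
        rw [map_zero]
        exact h.symm
      · change M.res _ s = M.res _ (0 : M.O W)
        rw [map_zero]
        exact hs
      · rfl)
  exact ⟨f, hf true⟩

/-- The component of parity `i` of any extension is again an extension: restriction respects parity,
so the other component restricts to zero on `U`. -/
theorem exists_extension_mem_parity {U : Opens M.X} {i : ZMod 2} {s : M.O U}
    (hs : s ∈ M.parity U i) (h : ∃ f : M.Functions, M.res le_top f = s) :
    ∃ f ∈ M.parity ⊤ i, M.res le_top f = s := by
  obtain ⟨f, rfl⟩ := h
  have hf : f ∈ M.parity ⊤ 0 ⊔ M.parity ⊤ 1 := by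
    rw [(M.isCompl_parity ⊤).sup_eq_top]; trivial
  obtain ⟨f₀, h₀, f₁, h₁, rfl⟩ := Submodule.mem_sup.mp hf
  have r₀ : M.res (le_top : U ≤ ⊤) f₀ ∈ M.parity U 0 := M.res_mem_parity U ⊤ le_top 0 f₀ h₀
  have r₁ : M.res (le_top : U ≤ ⊤) f₁ ∈ M.parity U 1 := M.res_mem_parity U ⊤ le_top 1 f₁ h₁
  have hdisj := Submodule.disjoint_def.mp (M.isCompl_parity U).disjoint
  rw [map_add] at hs
  have hi : i = 0 ∨ i = 1 := by
    fin_cases i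
    · exact Or.inl rfl
    · exact Or.inr rfl
  rcases hi with rfl | rfl
  · refine ⟨f₀, h₀, ?_⟩
    rw [map_add, hdisj _ ((Submodule.add_mem_iff_right _ r₀).mp hs) r₁, add_zero]
  · refine ⟨f₁, h₁, ?_⟩
    rw [map_add, hdisj _ r₀ ((Submodule.add_mem_iff_left _ r₁).mp hs), zero_add]

end SuperSpace

variable {M : SuperSpace.{u}} {p q : ℕ}

theorem coord_mem_parity (V : Opens (Fin p → ℝ)) (A : Idx p q) :
    coord V A ∈ SuperFun.parity V (Fin q) A.parity := by
  rcases A with i | j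
  · change SuperFun.involution V (Fin q) (_ ⊗ₜ 1) = sgn 0 • (_ ⊗ₜ 1)
    rw [SuperFun.involution_tmul, map_one, sgn_zero, one_smul]
  · change SuperFun.involution V (Fin q) (SuperFun.oddCoord V (Fin q) j)
      = sgn 1 • SuperFun.oddCoord V (Fin q) j
    rw [SuperFun.involution_oddCoord, sgn_one, neg_one_smul]

theorem tmul_one_mul_mem_parity {V : Opens (Fin p → ℝ)} {i : ZMod 2} {F : SuperFun V (Fin q)}
    (f : SmoothFun V) (hF : F ∈ SuperFun.parity V (Fin q) i) :
    f ⊗ₜ 1 * F ∈ SuperFun.parity V (Fin q) i := by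
  change SuperFun.involution V (Fin q) _ = sgn i • _
  rw [map_mul, SuperFun.involution_tmul, map_one, show SuperFun.involution V (Fin q) F = _ from hF,
    mul_smul_comm]

theorem eval_coordDeriv_tmul_one_mul_coord {V : Opens (Fin p → ℝ)} {a : V} {f : SmoothFun V}
    (hf : zeroExt V f.1 =ᶠ[nhds (a : Fin p → ℝ)] 1) (A B : Idx p q) :
    SuperFun.eval V (Fin q) a (coordDeriv V B (f ⊗ₜ 1 * coord V A)) = if B = A then 1 else 0 := by
  have hfa : f.1 a = 1 := by
    rw [← zeroExt_eq_of_mem V f.1 a.2, hf.self_of_nhds]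
    rfl
  have hAB : SuperFun.eval V (Fin q) a (if B = A then 1 else 0) = if B = A then 1 else 0 := by
    split_ifs
    · exact map_one _
    · exact map_zero _
  rcases B with i | j
  · have h : SuperFun.eval V (Fin q) a (coordDeriv V (Sum.inl i) (f ⊗ₜ 1)) = 0 := by
      refine (SuperFun.eval_tmul a (SmoothFun.deriv V (Pi.single i 1) f) 1).trans ?_
      rw [SmoothFun.deriv_apply, hf.fderiv_eq, fderiv_one]
      exact zero_smul _ _
    rw [coordDeriv_inl_mul, coordDeriv_coord, map_add, map_mul, map_mul, h, zero_mul, zero_add,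
      SuperFun.eval_tmul, hfa, one_smul, one_mul, hAB]
  · have h : coordDeriv V (Sum.inr j) (f ⊗ₜ 1) = 0 := SuperFun.oddDeriv_tmul_one _ _
    rw [coordDeriv_inr_mul, coordDeriv_coord, h, zero_mul, zero_add, map_mul,
      SuperFun.involution_tmul, map_one, SuperFun.eval_tmul, hfa, one_smul, one_mul, hAB]

namespace SuperChart

variable (c : SuperChart M p q)

theorem read_mem_parity_iff (i : ZMod 2) (a : M.O c.dom) :
    a ∈ M.parity c.dom i ↔ c.read a ∈ SuperFun.parity c.target (Fin q) i :=
  c.iso_parity c.target subset_rfl i a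

/-- Global homogeneous functions with the derivatives of a given coordinate at a given point. -/
theorem exists_function [IsSupermanifold M p q] (A : Idx p q) (a : c.target) :
    ∃ f ∈ M.parity ⊤ A.parity, ∀ B, SuperFun.eval c.target (Fin q) a
      (coordDeriv c.target B (c.read (M.res le_top f))) = if B = A then 1 else 0 := by
  have := IsSupermanifold.t2 (M := M) (p := p) (q := q)
  obtain ⟨χ, hχ⟩ := exists_contDiffBump c.target a
  let f : SmoothFun c.target := SmoothFun.mk c.target χ χ.contDiff.contDiffOn
  let G : SuperFun c.target (Fin q) := f ⊗ₜ 1 * coord c.target A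
  let K : Set (Fin p → ℝ) := Metric.closedBall (a : Fin p → ℝ) χ.rOut
  -- The support of the bump is compact, so its image is closed in the Hausdorff space M; this
  -- allows extension by zero.
  have hK : IsClosed (c.e.symm '' K) :=
    ((isCompact_closedBall _ _).image_of_continuousOn
      (c.e.continuousOn_symm.mono hχ)).isClosed
  let W : Opens M.X := ⟨(c.e.symm '' K)ᶜ, hK.isOpen_compl⟩
  let W' : Opens (Fin p → ℝ) := ⟨c.e.target \ K, c.e.open_target.sdiff Metric.isClosed_closedBall⟩
  have hW' : W' ≤ c.target := Set.sdiff_subset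
  have hcover : c.dom ⊔ W = ⊤ := by
    refine eq_top_iff.mpr fun m _ => ?_
    by_cases hm : m ∈ c.e.symm '' K
    · obtain ⟨y, hy, rfl⟩ := hm
      have h1 := c.e.map_target (hχ hy)
      exact Or.inl ⟨h1, c.e.map_source h1⟩
    · exact Or.inr hm
  have hle : c.dom ⊓ W ≤ preimageOpen c.e W' := by
    rintro m ⟨⟨h1, h2⟩, h3⟩
    refine ⟨h1, h2, fun hm => h3 ⟨c.e m, hm, c.e.left_inv h1⟩⟩
  have hG : SuperFun.res (Fin q) hW' G = 0 := by
    have : SmoothFun.res hW' f = 0 := by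
      ext x
      exact χ.zero_of_le_dist (not_le.mp x.2.2).le
    rw [map_mul]
    refine (congrArg (· * _) (?_ : _ = (0 : SuperFun W' (Fin q)))).trans (zero_mul _)
    change SmoothFun.res hW' f ⊗ₜ _ = _
    rw [this, TensorProduct.zero_tmul]
  have hle' : preimageOpen c.e W' ≤ c.dom := preimageOpen_mono c.e hW'
  have hs : M.res hle' (c.read.symm G) = 0 :=
    (c.iso W' hW').injective ((c.iso_res c.target W' subset_rfl hW' hW' (c.read.symm G)).trans
      ((congrArg (SuperFun.res (Fin q) hW') (c.read.apply_symm_apply G)).trans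
        (hG.trans (map_zero _).symm)))
  obtain ⟨F, hF, hFs⟩ := M.exists_extension_mem_parity (i := A.parity) (s := c.read.symm G)
    ((c.read_mem_parity_iff _ _).mpr (by
      rw [AlgEquiv.apply_symm_apply]
      exact tmul_one_mul_mem_parity _ (coord_mem_parity _ A)))
    (M.exists_extension hcover _
      ((M.res_res hle hle' _).symm.trans ((congrArg (M.res hle) hs).trans (map_zero _))))
  refine ⟨F, hF, fun B => ?_⟩
  rw [hFs, AlgEquiv.apply_symm_apply]
  refine eval_coordDeriv_tmul_one_mul_coord ?_ A B
  filter_upwards [χ.eventuallyEq_one, c.target.isOpen.mem_nhds a.2] with x hx hxt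
  rw [zeroExt_eq_of_mem _ _ hxt]
  exact hx

theorem eq_zero_of_poisson_cotLift_eq_zero [IsSupermanifold M p q] {F : CotFun c.target q} {k : ℝ}
    (hk : k ≠ 0) (hF : euler c.target q F = k • F)
    (h : ∀ (i : ZMod 2), ∀ f ∈ M.parity ⊤ i, poisson c.target F (cotLift p q f c) = 0) : F = 0 := by
  refine eq_zero_of_poisson_toCot_eq_zero hk hF
    (T := {g | ∃ i, ∃ f ∈ M.parity ⊤ i, g = c.read (M.res le_top f)}) ?_ ?_
  · intro A x
    obtain ⟨f, hf, h⟩ := c.exists_function A x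
    exact ⟨_, ⟨_, f, hf, rfl⟩, h⟩
  · rintro _ ⟨i, f, hf, rfl⟩
    exact h i f hf

/-- A vector field is determined by its symbol: `Q = Q(x^A) ∂/∂x^A`. -/
theorem read_act (Q : OddVectorField M) (a : M.O c.dom) :
    c.read (Q.act c.dom a)
      = ∑ A, c.read (Q.act c.dom (c.x A)) * coordDeriv c.target A (c.read a) := by
  let D : SuperFun c.target (Fin q) →ₗ[ℝ] SuperFun c.target (Fin q) :=
    c.read.toLinearMap ∘ₗ Q.act c.dom ∘ₗ c.read.symm.toLinearMap
  have hDa (F : SuperFun c.target (Fin q)) : D F = c.read (Q.act c.dom (c.read.symm F)) := rfl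
  have hom (i : ZMod 2) (F G : SuperFun c.target (Fin q))
      (hF : F ∈ SuperFun.parity c.target (Fin q) i) :
      D (F * G) = D F * G + SuperFun.involution c.target (Fin q) F * D G := by
    have hF' : c.read.symm F ∈ M.parity c.dom i := by
      rw [read_mem_parity_iff, AlgEquiv.apply_symm_apply]; exact hF
    rw [hDa, map_mul, Q.leibniz c.dom i _ _ hF', map_add, map_mul, map_smul, map_mul,
      AlgEquiv.apply_symm_apply, AlgEquiv.apply_symm_apply,
      show SuperFun.involution c.target (Fin q) F = sgn i • F from hF, smul_mul_assoc]
    rfl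
  have hD (F G : SuperFun c.target (Fin q)) :
      D (F * G) = D F * G + SuperFun.involution c.target (Fin q) F * D G := by
    -- The Leibniz rule is given only for a homogeneous first factor, so `F` is split into its even
    -- and odd halves.
    have h₀ : F + SuperFun.involution c.target (Fin q) F
        ∈ SuperFun.parity c.target (Fin q) 0 := by
      change SuperFun.involution c.target (Fin q) _ = sgn 0 • _
      rw [map_add, SuperFun.involution_involution, sgn_zero, one_smul, add_comm]
    have h₁ : F - SuperFun.involution c.target (Fin q) F
        ∈ SuperFun.parity c.target (Fin q) 1 := by
      change SuperFun.involution c.target (Fin q) _ = sgn 1 • _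
      rw [map_sub, SuperFun.involution_involution, sgn_one, neg_one_smul, neg_sub]
    have hdec : F = (1 / 2 : ℝ) • (F + SuperFun.involution c.target (Fin q) F)
        + (1 / 2 : ℝ) • (F - SuperFun.involution c.target (Fin q) F) := by
      module
    rw [hdec, add_mul, map_add, hom 0 _ _ (Submodule.smul_mem _ _ h₀),
      hom 1 _ _ (Submodule.smul_mem _ _ h₁), map_add, map_add, add_mul, add_mul]
    abel
  have h := derivation_eq_sum hD (fun A => by
    rw [hDa, ← read_mem_parity_iff]
    apply Q.act_parity
    rw [read_mem_parity_iff, AlgEquiv.apply_symm_apply]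
    exact coord_mem_parity _ A) (c.read a)
  rw [hDa, AlgEquiv.symm_apply_apply] at h
  exact h

end SuperChart

theorem euler_symbol (Q : OddVectorField M) (c : SuperChart M p q) :
    euler c.target q (Q.symbol p q c) = Q.symbol p q c :=
  euler_linear _

/-- The sign in the bracket cancels the one from `twist_derivP`, and the two twists of the
coefficient compose to the identity. -/
theorem poisson_linear_toCot {V : Opens (Fin p → ℝ)} (s : Idx p q → SuperFun V (Fin q))
    (f : SuperFun V (Fin q)) :
    poisson V (∑ A, toCot V q (s A) * mom V A) (toCot V q f)
      = toCot V q (∑ A, s A * coordDeriv V A f) := by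
  have h (A : Idx p q) : derivP V A (∑ B, toCot V q (s B) * mom V B)
      = twist V A (toCot V q (s A)) := by
    simp only [map_sum, derivP_mul, derivP_toCot, derivP_mom, zero_mul, zero_add, mul_ite, mul_one,
      mul_zero, Finset.sum_ite_eq, Finset.mem_univ, if_true]
  rw [poisson_toCot, map_sum]
  refine Finset.sum_congr rfl fun A _ => ?_
  rw [twist_derivP, h, twist_twist, smul_mul_assoc, smul_smul, sgn_mul_self, one_smul, map_mul]

/-- The Lie derivative of a function along an odd vector field is its Poisson bracket with the
symbol. -/
theorem cotLift_act (Q : OddVectorField M) (f : M.Functions) (c : SuperChart M p q) :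
    cotLift p q (Q.act ⊤ f) c = poisson c.target (Q.symbol p q c) (cotLift p q f c) := by
  rw [cotLift, ← Q.act_res, c.read_act]
  exact (poisson_linear_toCot _ _).symm

end Gluing

/-! ### Naturality under diffeomorphisms and recovery of 𝒬 and S. -/

section Diffeomorphisms

variable {M : SuperSpace.{u}} {p q : ℕ}

namespace SuperDiffeo

variable {N : SuperSpace.{u}} (φ : SuperDiffeo M N)

theorem pullCot_cotLift (f : N.Functions) :
    φ.pullCot (cotLift p q f) = cotLift p q (φ.pullFun f) := by
  funext c
  refine congrArg (toCot c.target q) (congrArg c.read ?_)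
  exact (congrArg (M.congr (φ.comap_preimageOpen c.e c.target))
    (φ.pull_res _ ⊤ le_top f)).trans (M.res_res _ _ _)

/-- True by definition: the transported chart has the same target, and the bracket is given by the
same formula in every chart. -/
theorem pullCot_cotPoisson (F G : CotFamily N p q) :
    φ.pullCot (cotPoisson F G) = cotPoisson (φ.pullCot F) (φ.pullCot G) := rfl

theorem pullCot_sub (F G : CotFamily N p q) : φ.pullCot (F - G) = φ.pullCot F - φ.pullCot G := rfl

theorem pullCot_smul (r : ℝ) (F : CotFamily N p q) : φ.pullCot (r • F) = r • φ.pullCot F := rfl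

theorem pullFun_one : φ.pullFun 1 = 1 := map_one (φ.pull ⊤)

theorem pullFun_mul (f g : N.Functions) : φ.pullFun (f * g) = φ.pullFun f * φ.pullFun g :=
  map_mul (φ.pull ⊤) f g

theorem exists_pullFun_eq {i : ZMod 2} {f : M.Functions} (hf : f ∈ M.parity ⊤ i) :
    ∃ g ∈ N.parity ⊤ i, φ.pullFun g = f :=
  ⟨(φ.pull ⊤).symm f, (φ.pull_parity ⊤ i _).mpr
    ((congrArg (· ∈ M.parity ⊤ i) ((φ.pull ⊤).apply_symm_apply f)).mpr hf),
    (φ.pull ⊤).apply_symm_apply f⟩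

end SuperDiffeo

theorem cotLift_mul (f g : M.Functions) :
    cotLift p q (f * g) = cotLift p q f * cotLift p q g := by
  funext c
  change toCot _ _ (c.read (M.res _ (f * g))) = _
  rw [map_mul, map_mul, map_mul]
  rfl

theorem coordDeriv_one (V : Opens (Fin p → ℝ)) (A : Idx p q) :
    coordDeriv V A (1 : SuperFun V (Fin q)) = 0 := by
  rcases A with i | j
  · have h := coordDeriv_inl_mul (V := V) i (1 : SuperFun V (Fin q)) 1
    rw [mul_one, mul_one, one_mul] at h
    exact left_eq_add.mp h
  · exact SuperFun.oddDeriv_tmul_one _ _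

theorem cotPoisson_one (F : CotFamily M p q) : cotPoisson F (cotLift p q 1) = 0 := by
  funext c
  change poisson _ _ (toCot _ _ (c.read (M.res _ 1))) = 0
  rw [map_one, map_one, poisson_toCot]
  simp only [coordDeriv_one, map_zero, mul_zero, smul_zero, Finset.sum_const_zero]

theorem cotPoisson_zero_left (F : CotFamily M p q) : cotPoisson 0 F = 0 := by
  funext c
  change poisson c.target 0 (F c) = 0
  simp only [poisson, map_zero, zero_mul, smul_zero, sub_zero, Finset.sum_const_zero]

theorem OddVectorField.act_one (Q : OddVectorField M) (U : Opens M.X) : Q.act U 1 = 0 := by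
  have h := Q.leibniz U 0 1 1 (M.one_mem_parity U)
  rw [mul_one, mul_one, one_mul, sgn_zero, one_smul] at h
  exact left_eq_add.mp h

theorem cotLift_act_eq (Q : OddVectorField M) (f : M.Functions) :
    cotLift p q (Q.act ⊤ f) = cotPoisson (Q.symbol p q) (cotLift p q f) :=
  funext fun c => cotLift_act Q f c

/-- The symbol is preserved as soon as the action on functions is. -/
theorem pullCot_symbol_eq [IsSupermanifold M p q] (Q : OddVectorField M) (φ : SuperDiffeo M M)
    (h : ∀ g : M.Functions, φ.pullCot (cotPoisson (Q.symbol p q) (cotLift p q g))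
      = cotPoisson (Q.symbol p q) (cotLift p q (φ.pullFun g))) :
    φ.pullCot (Q.symbol p q) = Q.symbol p q := by
  funext c
  rw [← sub_eq_zero]
  refine c.eq_zero_of_poisson_cotLift_eq_zero one_ne_zero ?_ fun i f hf => ?_
  · rw [one_smul, map_sub, euler_symbol]
    exact congrArg (· - _) (euler_symbol Q (φ.pushChart c))
  · obtain ⟨g, -, rfl⟩ := φ.exists_pullFun_eq hf
    have h' := congrFun (h g) c
    rw [φ.pullCot_cotPoisson, φ.pullCot_cotLift] at h'
    rw [poisson_sub_left]
    exact sub_eq_zero.mpr h'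

/-- Vanishing is tested twice: the difference of the two functions has degree 2, and its bracket
with a function of the base has degree 1. -/
theorem pullCot_quadratic_eq [IsSupermanifold M p q] {S : CotFamily M p q} (hS : IsQuadraticCot S)
    (φ : SuperDiffeo M M)
    (h : ∀ (i : ZMod 2) (f g : M.Functions), f ∈ M.parity ⊤ i →
      φ.pullCot (cotPoisson (cotPoisson S (cotLift p q f)) (cotLift p q g))
        = cotPoisson (cotPoisson S (cotLift p q (φ.pullFun f))) (cotLift p q (φ.pullFun g))) :
    φ.pullCot S = S := by
  funext c
  obtain ⟨s, hs⟩ := hS c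
  -- In the chart `c` the pull-back is the expression of `S` in the transported chart, hence
  -- quadratic as well.
  obtain ⟨s', hs'⟩ : ∃ s : Idx p q → Idx p q → SuperFun c.target (Fin q),
    φ.pullCot S c = (1 / 2 : ℝ) • ∑ A : Idx p q, ∑ B : Idx p q,
      toCot c.target q (s A B) * mom c.target B * mom c.target A := hS (φ.pushChart c)
  rw [← sub_eq_zero]
  refine c.eq_zero_of_poisson_cotLift_eq_zero two_ne_zero ?_ fun i f hf => ?_
  · rw [hs, hs', map_sub, euler_quadratic, euler_quadratic, smul_sub]
  · refine c.eq_zero_of_poisson_cotLift_eq_zero one_ne_zero ?_ fun j g hg => ?_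
    · rw [one_smul, poisson_sub_left, map_sub, hs, hs']
      exact congrArg₂ (· - ·) (euler_poisson_toCot_quadratic _ _)
        (euler_poisson_toCot_quadratic _ _)
    -- Every homogeneous function is a pull-back, so the hypothesis covers all test functions.
    · obtain ⟨f, hf', rfl⟩ := φ.exists_pullFun_eq hf
      obtain ⟨g, -, rfl⟩ := φ.exists_pullFun_eq hg
      have h' := congrFun (h i f g hf') c
      rw [φ.pullCot_cotPoisson, φ.pullCot_cotPoisson, φ.pullCot_cotLift, φ.pullCot_cotLift] at h'
      rw [poisson_sub_left, poisson_sub_left]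
      exact sub_eq_zero.mpr h'

/-! ### The odd Jacobi bracket and Hamiltonian vector fields. -/

namespace OddJacobiStructure

variable (J : OddJacobiStructure M p q)

theorem bracket_one (g : M.Functions) :
    J.bracket 0 1 g = cotPoisson (J.Q.symbol p q) (cotLift p q g) := by
  rw [bracket, cotPoisson_one, cotPoisson_zero_left, zero_add, sgn_one, smul_zero, one_mul]
  funext c
  change 0 - (-1 : ℝ) • poisson c.target (J.Q.symbol p q c) (cotLift p q g c) = _
  rw [neg_one_smul, zero_sub, neg_neg]
  rfl

theorem hamiltonian_one (g : M.Functions) :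
    J.hamiltonian 0 1 g = cotPoisson (J.Q.symbol p q) (cotLift p q g) := by
  have h : cotLift p q (0 : M.Functions) = 0 := by
    funext c
    change toCot _ _ (c.read (M.res _ 0)) = 0
    rw [map_zero, map_zero, map_zero]
  rw [hamiltonian, bracket_one, J.Q.act_one, zero_mul, h, sub_zero, sgn_zero, one_smul]

variable (φ : SuperDiffeo M M)

theorem preservesBracket_of_pullCot_eq (hS : φ.pullCot J.S = J.S)
    (hQ : φ.pullCot (J.Q.symbol p q) = J.Q.symbol p q) : J.PreservesBracket φ := by
  intro i f g _
  simp only [bracket, φ.pullCot_sub, φ.pullCot_smul, φ.pullCot_cotPoisson, φ.pullCot_cotLift, hS,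
    hQ, φ.pullFun_mul]

theorem pullCot_cotLift_act_mul (hQ : φ.pullCot (J.Q.symbol p q) = J.Q.symbol p q)
    (f g : M.Functions) :
    φ.pullCot (cotLift p q (J.Q.act ⊤ f * g))
      = cotLift p q (J.Q.act ⊤ (φ.pullFun f) * φ.pullFun g) := by
  have h : cotLift p q (φ.pullFun (J.Q.act ⊤ f)) = cotLift p q (J.Q.act ⊤ (φ.pullFun f)) := by
    rw [← φ.pullCot_cotLift, cotLift_act_eq, φ.pullCot_cotPoisson, hQ, φ.pullCot_cotLift,
      ← cotLift_act_eq]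
  rw [φ.pullCot_cotLift, φ.pullFun_mul, cotLift_mul, cotLift_mul, h]

/-- With 𝒬 preserved, the term {𝒬, fg} is natural and cancels; the remaining sign is invertible. -/
theorem pullCot_S_eq [IsSupermanifold M p q] (h : J.PreservesBracket φ)
    (hQ : φ.pullCot (J.Q.symbol p q) = J.Q.symbol p q) : φ.pullCot J.S = J.S := by
  refine pullCot_quadratic_eq J.isQuadratic_S φ fun i f g hf => ?_
  have h' := h i f g hf
  rw [bracket, bracket, φ.pullCot_sub, φ.pullCot_smul, φ.pullCot_smul,
    φ.pullCot_cotPoisson (J.Q.symbol p q), hQ, φ.pullCot_cotLift, φ.pullFun_mul,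
    sub_left_inj] at h'
  have h'' := congrArg (sgn (i + 1) • ·) h'
  simpa only [smul_smul, sgn_mul_self, one_smul] using h''

end OddJacobiStructure

end Diffeomorphisms

end OddJacobi

end

/-! ### The equivalence. -/

theorem mainTheorem8 {p q : ℕ} (M : OddJacobi.SuperSpace.{u}) [OddJacobi.IsSupermanifold M p q]
    (J : OddJacobi.OddJacobiStructure M p q) (φ : OddJacobi.SuperDiffeo M M) :
    List.TFAE [
      J.PreservesBracket φ,
      φ.pullCot J.S = J.S ∧ φ.pullCot (J.Q.symbol p q) = J.Q.symbol p q,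
      ∀ (i : ZMod 2) (f : M.Functions), f ∈ M.parity ⊤ i → J.HamiltonianRelated φ i f] := by
  tfae_have 1 → 2 := by
    intro h
    have hQ : φ.pullCot (J.Q.symbol p q) = J.Q.symbol p q := by
      refine OddJacobi.pullCot_symbol_eq J.Q φ fun g => ?_
      -- The bracket with f = 1 isolates the action of 𝒬.
      have h1 := h 0 1 g (M.one_mem_parity ⊤)
      rwa [φ.pullFun_one, J.bracket_one, J.bracket_one] at h1
    exact ⟨J.pullCot_S_eq φ h hQ, hQ⟩
  tfae_have 2 → 3 := by
    rintro ⟨hS, hQ⟩ i f hf g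
    rw [OddJacobi.OddJacobiStructure.hamiltonian, OddJacobi.OddJacobiStructure.hamiltonian,
      φ.pullCot_sub, φ.pullCot_smul, J.preservesBracket_of_pullCot_eq φ hS hQ i f g hf,
      J.pullCot_cotLift_act_mul φ hQ]
  tfae_have 3 → 1 := by
    intro h i f g hf
    have hQ : φ.pullCot (J.Q.symbol p q) = J.Q.symbol p q := by
      refine OddJacobi.pullCot_symbol_eq J.Q φ fun g => ?_
      -- Likewise X_1 is Q itself, because Q(1) = 0.
      have h1 := h 0 1 (M.one_mem_parity ⊤) g
      rwa [φ.pullFun_one, J.hamiltonian_one, J.hamiltonian_one] at h1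
    have h' := h i f hf g
    -- Since 𝒬 is preserved, the terms Q(f)g match and cancel, leaving the bracket up to the sign
    -- (-1)^f.
    rw [OddJacobi.OddJacobiStructure.hamiltonian, OddJacobi.OddJacobiStructure.hamiltonian,
      φ.pullCot_sub, φ.pullCot_smul, J.pullCot_cotLift_act_mul φ hQ, sub_left_inj] at h'
    have h'' := congrArg (OddJacobi.sgn i • ·) h'
    simpa only [smul_smul, OddJacobi.sgn_mul_self, one_smul] using h''
  tfae_finish
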